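/- Let $n\ge 3$ be an integer, $t=1+2\cos(\pi/n)$, $$A=\begin{pmatrix}1&t\\0&1\end{pmatrix},\qquad C=\begin{pmatrix}-1&1\\-1&0\end{pmatrix},\qquad U=AC\,(AC^{-1})^{n-2},$$ acting on $\mathbb R\cup\{\infty\}$ by Möbius transformations. For $\alpha\in[0,1]$ put $\ell_0(\alpha)=(\alpha-1)t$, $r_0(\alpha)=\alpha t$, $\mathbb I_\alpha=[\ell_0(\alpha),r_0(\alpha))$ and $T_\alpha(x)=A^kC^l\cdot x$, where $l\ge1$ is minimal with $C^l\cdot x\notin\mathbb I_\alpha$ and $k=-\lfloor (C^l\cdot x)/t+1-\alpha\rfloor$; the pair $(k,l)$ is the digit of $x$. If $C^l\cdot x=\infty$ put $T_\alpha(x)=\infty$ (then $x$ has no digit), and put $T_\alpha(\infty)=\infty$. Let $\ell_i(\alpha)=T_\alpha^i(\ell_0(\alpha))$ and $r_j(\alpha)=T_\alpha^j(r_0(\alpha))$. *Words.* For a word $v=c_1d_1c_2\cdots d_{s-1}c_s$ of positive integers, let $v'=1\,(c_1-1)\,d_1c_2\cdots c_s$ if $c_1\ne1$ and $v'=(d_1+1)\,c_2\cdots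 c_s$ if $c_1=1$, $s>1$. Let $\Theta_{-1}(c)=c+1$ for $c\ge 1$; $\Theta_q(1)=1\,q\,1$ for $q\ge1$; $\Theta_q(c)=c\,[1\,(c-1)]^q\,1\,c$ for $c\ge2$, $q\ge0$; and if $v=\Theta_p(u)=u\,v''$ with $p\ge0$, let $\Theta_q(v)=v\,(v')^q\,v''$ for $q\ge0$. Let $\mathcal V$ be the set of all words obtained from the word $1$ by finitely many applications of the operators $\Theta_q$. Let $k\ge2$ and $v=c_1d_1\cdots d_{s-1}c_s\in\mathcal V$. Put $$L_{-k,v}=(A^{-k}C)^{c_s}(A^{-k-1}C)^{d_{s-1}}(A^{-k}C)^{c_{s-1}}\cdots(A^{-k-1}C)^{d_1}(A^{-k}C)^{c_1}A^{-1},$$ $$R_{-k,v}=\tilde{\mathcal E}^{c_s}\tilde{\mathcal F}^{d_{s-1}}\tilde{\mathcal E}^{c_{s-1}}\cdots\tilde{\mathcal F}^{d_1}\tilde{\mathcal E}^{c_1}(AC^2)^{n-2},\quad \tilde{\mathcal E}=(AC^2)^{n-3}U^{k-2}AC,\quad \tilde{\mathcal F}=(AC^2)^{n-3}U^{k-1}AC,$$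 and, with $u=(1,2)^{n-2},(1,1)$, $\mathcal E=(1,1)\,u^{k-2}(1,2)^{n-3}$ and $\mathcal F=(1,1)\,u^{k-1}(1,2)^{n-3}$ (so that $\mathcal F=\mathcal E\mathcal G$ for $\mathcal G=(1,2)(1,1)(1,2)^{n-3}$), define the digit sequence $$\overline b(-k,v)=(1,2)^{n-2}\,\mathcal E^{c_1}\mathcal F^{d_1}\mathcal E^{c_2}\cdots\mathcal F^{d_{s-1}}\mathcal E^{c_s},$$ of length $\overline S$. Let $\underline S=c_1+d_1+\cdots+d_{s-1}+c_s$. **Proposition.** There are a unique $\eta\in[0,1]$ with $CA^{-1}CL_{-k,v}\cdot r_0(\eta)=C^{-1}\cdot\ell_0(\eta)$ and a unique $\zeta\in[0,1]$ with $L_{-k,v}A\cdot\ell_0(\zeta)=r_0(\zeta)$; one has $\eta<\zeta$. Let $\mathscr J_{-k,v}=[\eta,\zeta)$. Then $L_{-k,v}=\pm\,C^{-1}AC^2R_{-k,v}$, and for every $\alpha\in\mathscr J_{-k,v}$: 1. the first $\overline S$ digits of the $T_\alpha$-orbit of $r_0(\alpha)$ are $\overline b(-k,v)$; 2. $r_{\overline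 S}(\alpha)=R_{-k,v}\cdot r_0(\alpha)$ and $\ell_{\underline S}(\alpha)=L_{-k,v}\cdot r_0(\alpha)$; 3. synchronization occurs: if the digit of $r_{\overline S}(\alpha)$ is $(1,2)$ then $\ell_{\underline S+1}(\alpha)=r_{\overline S+2}(\alpha)$, and otherwise $\ell_{\underline S+1}(\alpha)=r_{\overline S+1}(\alpha)$. The common value is a real number, unless $L_{-k,v}\cdot r_0(\alpha)\in\{0,1\}$. -/

import Mathlib

open scoped OnePoint

namespace TriangleCF

/-! ### The triangle groups of signature `(3, n, ∞)` and the maps `T_α` -/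

section Maps

/-- `t = 2 cos (π/3) + 2 cos (π/n)`. -/
noncomputable def t (n : ℕ) : ℝ := 1 + 2 * Real.cos (Real.pi / n)

/-- The parabolic generator. -/
noncomputable def A (n : ℕ) : GL (Fin 2) ℝ :=
  Matrix.GeneralLinearGroup.mkOfDetNeZero !![1, t n; 0, 1] (by simp)

/-- The generator of (projective) order three; here `μ = 2 cos (π/3) = 1`. -/
noncomputable def C : GL (Fin 2) ℝ :=
  Matrix.GeneralLinearGroup.mkOfDetNeZero !![-1, 1; -1, 0] (by simp [Matrix.det_fin_two])

/-- The left endpoint `ℓ₀(α)`. -/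
noncomputable def ell0 (n : ℕ) (α : ℝ) : ℝ := (α - 1) * t n

/-- The right endpoint `r₀(α)`. -/
noncomputable def r0 (n : ℕ) (α : ℝ) : ℝ := α * t n

/-- The interval `𝕀_α = [(α - 1) t, α t)`, as a subset of the projective line
`ℝ ∪ {∞}`, on which `GL₂(ℝ)` acts by Möbius transformations. -/
def interval (n : ℕ) (α : ℝ) : Set (OnePoint ℝ) :=
  (fun x : ℝ => (x : OnePoint ℝ)) '' Set.Ico (ell0 n α) (r0 n α)

/-- The exponent of `C`: the least `l ≥ 1` with `C ^ l · x ∉ 𝕀_α`. -/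
noncomputable def cExp (n : ℕ) (α : ℝ) (x : OnePoint ℝ) : ℕ :=
  sInf {l : ℕ | 1 ≤ l ∧ C ^ l • x ∉ interval n α}

/-- The exponent of `A` that brings `z` back to `𝕀_α`, namely `-⌊z / t + 1 - α⌋`.
The value at `∞` is irrelevant, since every power of `A` fixes `∞`. -/
noncomputable def aExp (n : ℕ) (α : ℝ) (z : OnePoint ℝ) : ℤ :=
  z.elim 0 (fun y : ℝ => -⌊y / t n + 1 - α⌋)

open Classical in
/-- The map `T_α : x ↦ A ^ k C ^ l · x`. It takes the value `∞` at the poles of its branches,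
and `T_α ∞ = ∞` by convention: an orbit that has left the real line stops. -/
noncomputable def T (n : ℕ) (α : ℝ) (x : OnePoint ℝ) : OnePoint ℝ :=
  if x = ∞ then ∞
  else A n ^ aExp n α (C ^ cExp n α x • x) • C ^ cExp n α x • x

open Classical in
/-- The `α`-digit `(k, l)` of `x`; there is none at `∞` and at the poles of `T_α`. -/
noncomputable def digit (n : ℕ) (α : ℝ) (x : OnePoint ℝ) : Option (ℤ × ℕ) :=
  if T n α x = ∞ then none
  else some (aExp n α (C ^ cExp n α x • x), cExp n α x)

/-- `ℓ_i(α) = T_α^i (ℓ₀(α))`. -/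
noncomputable def ell (n : ℕ) (α : ℝ) (i : ℕ) : OnePoint ℝ := (T n α)^[i] (ell0 n α : ℝ)

/-- `r_j(α) = T_α^j (r₀(α))`. -/
noncomputable def r (n : ℕ) (α : ℝ) (j : ℕ) : OnePoint ℝ := (T n α)^[j] (r0 n α : ℝ)

/-- The first `N` digits of the orbit of `r₀(α)`. -/
noncomputable def upperDigits (n : ℕ) (α : ℝ) (N : ℕ) : List (Option (ℤ × ℕ)) :=
  (List.range N).map fun j => digit n α (r n α j)

end Maps

/-! ### The tree of words

A word `c₁ d₁ c₂ d₂ ⋯ d_{s-1} c_s` is the list of its letters. -/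

section Words

/-- The word `v'`. -/
def prime : List ℕ → List ℕ
  | [] => []
  | [c] => if c = 1 then [1] else [1, c - 1]
  | c :: d :: w => if c = 1 then (d + 1) :: w else 1 :: (c - 1) :: d :: w

/-- The power `w ^ q` of a word, that is `w` concatenated with itself `q` times. -/
def wpow {β : Type*} (w : List β) (q : ℕ) : List β := (List.replicate q w).flatten

/-- `IsTheta q u v` says that `v = Θ_q(u)`. In the last clause, the word to which `Θ_q` is
applied is `u ++ x = Θ_p(u)`, with `p ≥ 0`, and `x` is its suffix `(u ++ x)''`. -/
inductive IsTheta : ℤ → List ℕ → List ℕ → Prop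
  | neg_one (c : ℕ) (hc : 1 ≤ c) : IsTheta (-1) [c] [c + 1]
  | of_one (q : ℕ) (hq : 1 ≤ q) : IsTheta q [1] [1, q, 1]
  | of_single (c q : ℕ) (hc : 2 ≤ c) :
      IsTheta q [c] ([c] ++ wpow [1, c - 1] q ++ [1, c])
  | step (p q : ℕ) (u x : List ℕ) (h : IsTheta p u (u ++ x)) :
      IsTheta q (u ++ x) ((u ++ x) ++ wpow (prime (u ++ x)) q ++ x)

/-- The tree `𝒱`: all words obtained from the word `1` by finitely many applications of the
operators `Θ_q`. -/
inductive IsTreeWord : List ℕ → Prop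
  | root : IsTreeWord [1]
  | child (q : ℤ) (u v : List ℕ) (hu : IsTreeWord u) (h : IsTheta q u v) : IsTreeWord v

/-- For `v = c₁ d₁ ⋯ d_{s-1} c_s`, the concatenation
`E ^ c₁, F ^ d₁, E ^ c₂, ⋯, F ^ d_{s-1}, E ^ c_s`. -/
def expand {β : Type*} : List β → List β → List ℕ → List β
  | _, _, [] => []
  | E, F, c :: w => wpow E c ++ expand F E w

/-- For `v = c₁ d₁ ⋯ d_{s-1} c_s`, the product (in the reversed order)
`E ^ c_s * F ^ d_{s-1} * ⋯ * F ^ d₁ * E ^ c₁`. -/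
def expandMul {G : Type*} [Group G] : G → G → List ℕ → G
  | _, _, [] => 1
  | E, F, c :: w => expandMul F E w * E ^ c

end Words

/-! ### Digit sequences, matrices and synchronization intervals -/

section Sequences

/-- `u = (1,2)^{n-2}, (1,1)`. -/
def uWord (n : ℕ) : List (ℤ × ℕ) := wpow [(1, 2)] (n - 2) ++ [(1, 1)]

/-- The block `ℰ = (1,1) u^{k-2} (1,2)^{n-3}`. -/
def blockE (n k : ℕ) : List (ℤ × ℕ) :=
  [(1, 1)] ++ wpow (uWord n) (k - 2) ++ wpow [(1, 2)] (n - 3)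

/-- The block `ℱ = (1,1) u^{k-1} (1,2)^{n-3}`. -/
def blockF (n k : ℕ) : List (ℤ × ℕ) :=
  [(1, 1)] ++ wpow (uWord n) (k - 1) ++ wpow [(1, 2)] (n - 3)

/-- The upper digit sequence of `-k, v`. -/
def upperSeq (n k : ℕ) (v : List ℕ) : List (ℤ × ℕ) :=
  wpow [(1, 2)] (n - 2) ++ expand (blockE n k) (blockF n k) v

/-- The length of the upper digit sequence of `-k, v`. -/
def upperLen (n k : ℕ) (v : List ℕ) : ℕ := (upperSeq n k v).length

/-- The length of the lower digit sequence
`(-k)^{c₁}, (-k-1)^{d₁}, ⋯, (-k-1)^{d_{s-1}}, (-k)^{c_s}` of `-k, v`. -/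
def lowerLen (v : List ℕ) : ℕ := v.sum

/-- `U = A C (A C⁻¹)^{n-2}`. -/
noncomputable def U (n : ℕ) : GL (Fin 2) ℝ := A n * C * (A n * C⁻¹) ^ (n - 2)

/-- The matrix `(A C²)^{n-3} U^{k-2} A C` of the block `ℰ`. -/
noncomputable def matE (n k : ℕ) : GL (Fin 2) ℝ :=
  (A n * C ^ 2) ^ (n - 3) * U n ^ (k - 2) * (A n * C)

/-- The matrix `(A C²)^{n-3} U^{k-1} A C` of the block `ℱ`. -/
noncomputable def matF (n k : ℕ) : GL (Fin 2) ℝ :=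
  (A n * C ^ 2) ^ (n - 3) * U n ^ (k - 1) * (A n * C)

/-- The right matrix `R_{-k,v}`. -/
noncomputable def R (n k : ℕ) (v : List ℕ) : GL (Fin 2) ℝ :=
  expandMul (matE n k) (matF n k) v * (A n * C ^ 2) ^ (n - 2)

/-- The left matrix `L_{-k,v}`. -/
noncomputable def L (n k : ℕ) (v : List ℕ) : GL (Fin 2) ℝ :=
  expandMul (A n ^ (-(k : ℤ)) * C) (A n ^ (-(k : ℤ) - 1) * C) v * (A n)⁻¹

/-- The parameter `ζ` satisfies `L_{-k,v} A · ℓ₀(ζ) = r₀(ζ)`. -/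
def IsZeta (n k : ℕ) (v : List ℕ) (ζ : ℝ) : Prop :=
  ζ ∈ Set.Icc (0 : ℝ) 1 ∧
    (L n k v * A n) • ((ell0 n ζ : ℝ) : OnePoint ℝ) = ((r0 n ζ : ℝ) : OnePoint ℝ)

/-- The parameter `η` satisfies `C A⁻¹ C L_{-k,v} · r₀(η) = C⁻¹ · ℓ₀(η)`. -/
def IsEta (n k : ℕ) (v : List ℕ) (η : ℝ) : Prop :=
  η ∈ Set.Icc (0 : ℝ) 1 ∧
    (C * (A n)⁻¹ * C * L n k v) • ((r0 n η : ℝ) : OnePoint ℝ) =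
      C⁻¹ • ((ell0 n η : ℝ) : OnePoint ℝ)

/-- The synchronization interval `𝒥_{-k,v} = [η, ζ)`. -/
def syncInterval (n k : ℕ) (v : List ℕ) : Set ℝ :=
  {α | ∃ η ζ : ℝ, IsEta n k v η ∧ IsZeta n k v ζ ∧ α ∈ Set.Ico η ζ}

end Sequences

end TriangleCF

namespace TriangleCF

/-! ### Möbius transformations -/

/-! Put `z = -ell0 n α` and write the points of the left orbit as `-s`. The elliptic element `B = A
C²` has determinant `1` and trace `2 cos (π/n)`, so `B ^ n = -1`. Trading long powers of `B` for
short powers of `B⁻¹` makes `U` a conjugate of `A⁻¹`, and makes the blocks `ℰ`, `ℱ` the conjugates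
by `M = C⁻¹ A C²` of `A ^ (-k) C`, `A ^ (-k-1) C` (`block_projEq`). Hence `L = ±M R`, and at the
ends of blocks the right orbit is the image under `M⁻¹` of the left one: `mirror s = M⁻¹ · (-s)`.

Let `ω` be the binary word of `v`. Undoing a left digit is the map `invBranch` in the coordinate
`s`; it is increasing, contracts by `1/4`, and is larger for the letter `true`. The equation `L ·
r₀(α) = -w` becomes `val n k w ω = z`. The parameter `η` is the case `w = lowEnd n z`, and `ζ` is
the case `w = z - t`. Both are fixed-point equations in `z` for contractions, which gives existence,
uniqueness and `η < ζ`; for `α ∈ [η, ζ)` the intermediate value theorem gives `w ∈ (z - t, lowEnd n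
z]`.

All digits are as claimed once every nonempty suffix of `ω` has its value in `(lowEnd n z, z]`: the
upper bound keeps left points above `ℓ₀`, and the lower bound keeps the first point inside each
right block below `r₀` (`Follows.left`, `Follows.right`). Values are ordered lexicographically, so
the bounds follow from the combinatorial condition `Admissible` (`val_suffix_bounds`). It holds on
the tree because `ω` is a power of `true` or has the form `1p1` with `p` a central word: `0p1` and
`1p0` are Lyndon for opposite orders, and each gives one half of the condition
(`CentralPair.admissible`).

Finally, `C² M⁻¹ = A⁻¹ C`, and `w ≤ lowEnd n z` forces the exponent of `C` at `mirror n w` to be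
`2`. So the next right point is `C · (-w)` reduced modulo `t`, and `synchronization` is a case
distinction on whether `C · (-w)` already lies in `𝕀_α`. -/

lemma coe_C : (C : Matrix (Fin 2) (Fin 2) ℝ) = !![-1, 1; -1, 0] := rfl

lemma coe_A (n : ℕ) : (A n : Matrix (Fin 2) (Fin 2) ℝ) = !![1, t n; 0, 1] := rfl

lemma C_sq_coe : ((C ^ 2 : GL (Fin 2) ℝ) : Matrix (Fin 2) (Fin 2) ℝ) = !![0, -1; 1, -1] := by
  rw [Units.val_pow_eq_pow_val, coe_C, pow_two]
  ext i j
  fin_cases i <;> fin_cases j <;> norm_num [Matrix.mul_apply, Fin.sum_univ_two]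

lemma C_pow_three : C ^ 3 = 1 := by
  apply Units.ext
  rw [pow_succ, Units.val_mul, C_sq_coe, coe_C]
  ext i j
  fin_cases i <;> fin_cases j <;> norm_num [Matrix.mul_apply, Fin.sum_univ_two]

lemma C_inv : C⁻¹ = C ^ 2 := by
  rw [inv_eq_iff_mul_eq_one, ← pow_succ', C_pow_three]

lemma C_smul {x : ℝ} (hx : x ≠ 0) : C • (x : OnePoint ℝ) = ((1 - 1 / x : ℝ) : OnePoint ℝ) := by
  rw [OnePoint.smul_some_eq_ite, coe_C]
  simp [hx]
  field_simp
  ring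

lemma C_smul_zero : C • ((0 : ℝ) : OnePoint ℝ) = ∞ := by
  rw [OnePoint.smul_some_eq_ite, coe_C]
  simp

lemma C_smul_infty : C • (∞ : OnePoint ℝ) = ((1 : ℝ) : OnePoint ℝ) := by
  rw [OnePoint.smul_infty_eq_ite, coe_C]
  simp

lemma C_sq_smul {x : ℝ} (hx : x ≠ 1) :
    C ^ 2 • (x : OnePoint ℝ) = ((1 / (1 - x) : ℝ) : OnePoint ℝ) := by
  have h : x - 1 ≠ 0 := sub_ne_zero.mpr hx
  have h' : 1 - x ≠ 0 := sub_ne_zero.mpr hx.symm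
  rw [OnePoint.smul_some_eq_ite, C_sq_coe]
  simp only [Matrix.of_apply, Matrix.cons_val', Matrix.cons_val_zero, Matrix.cons_val_one,
    Matrix.cons_val_fin_one]
  rw [if_neg (by intro h0; apply h; linarith)]
  congr 1
  have e : 1 * x + -1 = -(1 - x) := by ring
  rw [e, div_neg, ← neg_div]
  norm_num

lemma C_sq_smul_one : C ^ 2 • ((1 : ℝ) : OnePoint ℝ) = ∞ := by
  rw [OnePoint.smul_some_eq_ite, C_sq_coe]
  simp

lemma C_sq_smul_infty : C ^ 2 • (∞ : OnePoint ℝ) = ((0 : ℝ) : OnePoint ℝ) := by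
  rw [OnePoint.smul_infty_eq_ite, C_sq_coe]
  simp

lemma A_smul (n : ℕ) (x : ℝ) : A n • (x : OnePoint ℝ) = ((x + t n : ℝ) : OnePoint ℝ) := by
  rw [OnePoint.smul_some_eq_ite, coe_A]
  simp

lemma A_smul_infty (n : ℕ) : A n • (∞ : OnePoint ℝ) = ∞ := by
  rw [OnePoint.smul_infty_eq_ite, coe_A]
  simp

lemma A_inv_smul (n : ℕ) (x : ℝ) :
    (A n)⁻¹ • (x : OnePoint ℝ) = ((x - t n : ℝ) : OnePoint ℝ) := by
  rw [inv_smul_eq_iff, A_smul, sub_add_cancel]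

lemma A_inv_smul_infty (n : ℕ) : (A n)⁻¹ • (∞ : OnePoint ℝ) = ∞ := by
  rw [inv_smul_eq_iff, A_smul_infty]

lemma A_zpow_smul (n : ℕ) (k : ℤ) (x : ℝ) :
    A n ^ k • (x : OnePoint ℝ) = ((x + k * t n : ℝ) : OnePoint ℝ) := by
  induction k with
  | zero => simp
  | succ k ih =>
    rw [add_comm (k : ℤ) 1, zpow_add, mul_smul, ih, zpow_one, A_smul]
    congr 1
    push_cast
    ring
  | pred k ih =>
    rw [sub_eq_add_neg, add_comm, zpow_add, mul_smul, ih, zpow_neg_one, A_inv_smul]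
    congr 1
    push_cast
    ring

lemma A_zpow_smul_infty (n : ℕ) (k : ℤ) : A n ^ k • (∞ : OnePoint ℝ) = ∞ := by
  induction k with
  | zero => simp
  | succ k ih => rw [add_comm (k : ℤ) 1, zpow_add, mul_smul, ih, zpow_one, A_smul_infty]
  | pred k ih =>
    rw [sub_eq_add_neg, add_comm, zpow_add, mul_smul, ih, zpow_neg_one, A_inv_smul_infty]

lemma neg_smul_onePoint (g : GL (Fin 2) ℝ) (x : OnePoint ℝ) : (-g) • x = g • x := by
  induction x using OnePoint.rec with
  | infty =>
    simp [OnePoint.smul_infty_eq_ite]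
  | coe x =>
    have e : -(g 1 0 * x) + -g 1 1 = -(g 1 0 * x + g 1 1) := by ring
    have e' : -(g 0 0 * x) + -g 0 1 = -(g 0 0 * x + g 0 1) := by ring
    simp only [OnePoint.smul_some_eq_ite, Units.val_neg, Matrix.neg_apply, neg_mul, e, e',
      neg_eq_zero]
    split_ifs
    · rfl
    · exact congrArg _ (neg_div_neg_eq _ _)

/-! ### Identities in the projective group -/

/-- Equality in the projective group, that is, up to sign. -/
def ProjEq (g h : GL (Fin 2) ℝ) : Prop := g = h ∨ g = -h

lemma ProjEq.refl (g : GL (Fin 2) ℝ) : ProjEq g g := Or.inl rfl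

lemma ProjEq.of_eq {g h : GL (Fin 2) ℝ} (e : g = h) : ProjEq g h := Or.inl e

lemma ProjEq.trans {f g h : GL (Fin 2) ℝ} (h₁ : ProjEq f g) (h₂ : ProjEq g h) : ProjEq f h := by
  rcases h₁ with rfl | rfl <;> rcases h₂ with rfl | rfl <;> simp [ProjEq]

lemma ProjEq.symm {g h : GL (Fin 2) ℝ} (h₁ : ProjEq g h) : ProjEq h g := by
  rcases h₁ with rfl | rfl <;> simp [ProjEq]

lemma ProjEq.mul {f f' g g' : GL (Fin 2) ℝ} (h₁ : ProjEq f f') (h₂ : ProjEq g g') :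
    ProjEq (f * g) (f' * g') := by
  rcases h₁ with rfl | rfl <;> rcases h₂ with rfl | rfl <;> simp [ProjEq]

lemma ProjEq.pow {f g : GL (Fin 2) ℝ} (h : ProjEq f g) (m : ℕ) : ProjEq (f ^ m) (g ^ m) := by
  induction m with
  | zero => simpa using ProjEq.refl 1
  | succ m ih => rw [pow_succ, pow_succ]; exact ih.mul h

lemma ProjEq.smul_eq {g h : GL (Fin 2) ℝ} (e : ProjEq g h) (x : OnePoint ℝ) : g • x = h • x := by
  rcases e with rfl | rfl
  · rfl
  · exact neg_smul_onePoint h x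

/-- The elliptic element `A C²`. -/
noncomputable def B (n : ℕ) : GL (Fin 2) ℝ := A n * C ^ 2

lemma coe_B (n : ℕ) :
    (B n : Matrix (Fin 2) (Fin 2) ℝ) = !![t n, -1 - t n; 1, -1] := by
  rw [B, Units.val_mul, C_sq_coe, coe_A]
  ext i j
  fin_cases i <;> fin_cases j <;> norm_num [Matrix.mul_apply, Fin.sum_univ_two]
  ring

/-- Cayley–Hamilton gives `B² = 2 cos θ · B - 1` with `θ = π/n`, so powers of `B` obey the
recurrence of `sin (m θ)`. The factor `sin θ` avoids a division. -/
lemma B_pow_mul_sin (n m : ℕ) :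
    Real.sin (Real.pi / n) • (B n : Matrix (Fin 2) (Fin 2) ℝ) ^ (m + 1) =
      Real.sin ((m + 1 : ℕ) * (Real.pi / n)) • (B n : Matrix (Fin 2) (Fin 2) ℝ) -
        Real.sin (m * (Real.pi / n)) • 1 := by
  set θ := Real.pi / n with hθ
  induction m with
  | zero => simp
  | succ m ih =>
    have hsq : (B n : Matrix (Fin 2) (Fin 2) ℝ) * B n =
        (2 * Real.cos θ) • (B n : Matrix (Fin 2) (Fin 2) ℝ) - 1 := by
      rw [coe_B]
      ext i j
      fin_cases i <;> fin_cases j <;> simp [Matrix.mul_apply, Fin.sum_univ_two, t, ← hθ] <;> ring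
    have hs : Real.sin ((m + 1 + 1 : ℕ) * θ) =
        2 * Real.cos θ * Real.sin ((m + 1 : ℕ) * θ) - Real.sin (m * θ) := by
      have h₁ : ((m + 1 + 1 : ℕ) : ℝ) * θ = ((m + 1 : ℕ) : ℝ) * θ + θ := by push_cast; ring
      have h₂ : (m : ℝ) * θ = ((m + 1 : ℕ) : ℝ) * θ - θ := by push_cast; ring
      rw [h₁, h₂, Real.sin_add, Real.sin_sub]
      ring
    rw [pow_succ, ← smul_mul_assoc, ih, sub_mul, smul_mul_assoc, hsq, hs]
    simp only [smul_sub, smul_smul, smul_mul_assoc, one_mul, sub_smul]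
    rw [mul_comm]
    abel

lemma B_pow_self {n : ℕ} (hn : 3 ≤ n) : B n ^ n = -1 := by
  have hn' : (n : ℝ) ≠ 0 := by positivity
  have hpos : 0 < Real.sin (Real.pi / n) := by
    apply Real.sin_pos_of_pos_of_lt_pi
    · positivity
    · apply div_lt_self Real.pi_pos
      exact_mod_cast (by omega : 1 < n)
  obtain ⟨m, rfl⟩ : ∃ m, n = m + 1 := ⟨n - 1, by omega⟩
  have h := B_pow_mul_sin (m + 1) m
  have h₁ : ((m + 1 : ℕ) : ℝ) * (Real.pi / (m + 1 : ℕ)) = Real.pi := by field_simp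
  have h₂ : (m : ℝ) * (Real.pi / (m + 1 : ℕ)) = Real.pi - Real.pi / (m + 1 : ℕ) := by
    have : (m : ℝ) = ((m + 1 : ℕ) : ℝ) - 1 := by push_cast; ring
    rw [this]
    field_simp
  rw [h₁, h₂, Real.sin_pi, Real.sin_pi_sub, zero_smul, zero_sub, ← smul_neg] at h
  apply Units.ext
  rw [Units.val_pow_eq_pow_val, Units.val_neg, Units.val_one]
  exact smul_right_injective _ hpos.ne' h

lemma B_inv_pow {n : ℕ} (hn : 3 ≤ n) {i j : ℕ} (h : i + j = n) :
    ProjEq ((B n)⁻¹ ^ i) (B n ^ j) := by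
  right
  rw [inv_pow, inv_eq_iff_mul_eq_one, mul_neg, ← pow_add, h, B_pow_self hn, neg_neg]

lemma B_pow {n : ℕ} (hn : 3 ≤ n) {i j : ℕ} (h : i + j = n) :
    ProjEq (B n ^ i) ((B n)⁻¹ ^ j) :=
  (B_inv_pow hn (by omega)).symm

/-- Since `B ^ (n-2) = ±B⁻²`, the long word `U` collapses to a parabolic element. -/
lemma U_projEq {n : ℕ} (hn : 3 ≤ n) : ProjEq (U n) (B n * (A n)⁻¹ * (B n)⁻¹) := by
  have e : U n = (A n * C) * B n ^ (n - 2) := by rw [U, C_inv, ← B]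
  rw [e]
  refine ((ProjEq.refl _).mul (B_pow hn (j := 2) (by omega))).trans (ProjEq.of_eq ?_)
  rw [B, mul_inv_rev, ← C_inv, inv_inv, pow_two]
  have : C * C = C⁻¹ := by rw [C_inv, pow_two]
  calc A n * C * (C * (A n)⁻¹ * (C * (A n)⁻¹)) = A n * (C * C) * (A n)⁻¹ * (C * (A n)⁻¹) := by group
    _ = _ := by rw [this]

lemma U_pow_projEq {n : ℕ} (hn : 3 ≤ n) (m : ℕ) :
    ProjEq (U n ^ m) (B n * (A n) ^ (-(m : ℤ)) * (B n)⁻¹) := by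
  refine ((U_projEq hn).pow m).trans (ProjEq.of_eq ?_)
  rw [conj_pow, zpow_neg, zpow_natCast, inv_pow]

/-- The matrix that carries the right orbit to the left one. -/
noncomputable def M (n : ℕ) : GL (Fin 2) ℝ := C⁻¹ * B n

lemma M_eq (n : ℕ) : M n = C⁻¹ * A n * C ^ 2 := by rw [M, B, mul_assoc]

lemma M_inv (n : ℕ) : (M n)⁻¹ = C * (A n)⁻¹ * C := by
  rw [M, B, ← C_inv]
  group

/-- The exponent `n - 3` becomes `-3`. After cancellation both sides equal `C A⁻¹ C A ^ (-m-1) C⁻¹`;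
the cases `m = k - 2` and `m = k - 1` are the two blocks. -/
lemma block_projEq {n : ℕ} (hn : 3 ≤ n) (m : ℕ) :
    ProjEq ((B n) ^ (n - 3) * U n ^ m * (A n * C))
      ((M n)⁻¹ * (A n ^ (-(m : ℤ) - 2) * C) * M n) := by
  refine (((B_pow hn (j := 3) (by omega)).mul (U_pow_projEq hn m)).mul
    (ProjEq.refl (A n * C))).trans (ProjEq.of_eq ?_)
  have h : B n = A n * C⁻¹ := by rw [B, C_inv]
  have hC : C * C = C⁻¹ := by rw [C_inv, pow_two]
  have e₁ : (B n)⁻¹ ^ 3 * (B n * A n ^ (-(m : ℤ)) * (B n)⁻¹) * (A n * C) =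
      C * (A n)⁻¹ * C * (A n ^ (-(m : ℤ) - 1)) * (C * C) := by
    rw [h]
    simp only [pow_succ, pow_zero, one_mul, mul_inv_rev, inv_inv, zpow_sub, zpow_one]
    group
  have e₂ : (M n)⁻¹ * (A n ^ (-(m : ℤ) - 2) * C) * M n =
      C * (A n)⁻¹ * C * (A n ^ (-(m : ℤ) - 1)) * C⁻¹ := by
    rw [M_inv, M, h]
    group
  rw [e₁, e₂, hC]

lemma matE_projEq {n k : ℕ} (hn : 3 ≤ n) (hk : 2 ≤ k) :
    ProjEq (matE n k) ((M n)⁻¹ * (A n ^ (-(k : ℤ)) * C) * M n) := by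
  have h := block_projEq hn (k - 2)
  have e : (-((k - 2 : ℕ) : ℤ) - 2) = -(k : ℤ) := by omega
  rwa [e] at h

lemma matF_projEq {n k : ℕ} (hn : 3 ≤ n) (hk : 2 ≤ k) :
    ProjEq (matF n k) ((M n)⁻¹ * (A n ^ (-(k : ℤ) - 1) * C) * M n) := by
  have h := block_projEq hn (k - 1)
  have e : (-((k - 1 : ℕ) : ℤ) - 2) = -(k : ℤ) - 1 := by omega
  rwa [e] at h

lemma expandMul_projEq {E F E' F' g : GL (Fin 2) ℝ} (hE : ProjEq E (g⁻¹ * E' * g))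
    (hF : ProjEq F (g⁻¹ * F' * g)) (v : List ℕ) :
    ProjEq (expandMul E F v) (g⁻¹ * expandMul E' F' v * g) := by
  induction v generalizing E F E' F' with
  | nil => exact ProjEq.of_eq (by simp [expandMul])
  | cons c w ih =>
    refine ((ih hF hE).mul (hE.pow c)).trans (ProjEq.of_eq ?_)
    have e : (g⁻¹ * E' * g) ^ c = g⁻¹ * E' ^ c * g := by
      simpa using conj_pow (a := g⁻¹) (b := E') (i := c)
    rw [e, expandMul]
    group

/-- The left and the right matrix agree up to `M`. -/
lemma L_projEq {n k : ℕ} (hn : 3 ≤ n) (hk : 2 ≤ k) (v : List ℕ) :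
    ProjEq (L n k v) (M n * R n k v) := by
  have h := expandMul_projEq (matE_projEq hn hk) (matF_projEq hn hk) v
  refine ProjEq.symm (((ProjEq.refl (M n)).mul (h.mul (B_pow hn (i := n - 2) (j := 2)
    (by omega)))).trans (ProjEq.of_eq ?_))
  rw [L, M, B, ← C_inv, pow_two]
  group

/-! ### Bounds on `t` and the elliptic orbit of the pole -/

lemma two_le_t {n : ℕ} (hn : 3 ≤ n) : 2 ≤ t n := by
  have hn' : (3 : ℝ) ≤ n := by exact_mod_cast hn
  have h : Real.cos (Real.pi / 3) ≤ Real.cos (Real.pi / n) := by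
    apply Real.cos_le_cos_of_nonneg_of_le_pi
    · positivity
    · linarith [Real.pi_pos]
    · gcongr
  rw [Real.cos_pi_div_three] at h
  rw [t]
  linarith

lemma t_lt_three {n : ℕ} (hn : 3 ≤ n) : t n < 3 := by
  have hn' : (0 : ℝ) < n := by positivity
  have h : Real.cos (Real.pi / n) < Real.cos 0 := by
    apply Real.cos_lt_cos_of_nonneg_of_le_pi le_rfl
    · exact div_le_self Real.pi_pos.le (by exact_mod_cast (by omega : 1 ≤ n))
    · exact div_pos Real.pi_pos hn'
  rw [Real.cos_zero] at h
  rw [t]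
  linarith

/-- The point `(A C²)^{-j} · 1`. -/
noncomputable def poleOrbit (n j : ℕ) : ℝ :=
  1 + Real.sin (j * (Real.pi / n)) / Real.sin ((j + 1 : ℕ) * (Real.pi / n))

lemma sin_mul_pi_div_pos {n j : ℕ} (hj : 0 < j) (hjn : j < n) :
    0 < Real.sin (j * (Real.pi / n)) := by
  have hn : (0 : ℝ) < n := by exact_mod_cast (by omega : 0 < n)
  have hj' : (0 : ℝ) < j := by exact_mod_cast hj
  have hjn' : (j : ℝ) < n := by exact_mod_cast hjn
  apply Real.sin_pos_of_pos_of_lt_pi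
  · have := Real.pi_pos
    positivity
  · rw [← mul_div_assoc, div_lt_iff₀ hn, mul_comm]
    exact mul_lt_mul_of_pos_left hjn' Real.pi_pos

lemma t_sub_poleOrbit {n j : ℕ} (hj : j + 2 < n) :
    t n - poleOrbit n j =
      Real.sin ((j + 2 : ℕ) * (Real.pi / n)) / Real.sin ((j + 1 : ℕ) * (Real.pi / n)) := by
  have h := (sin_mul_pi_div_pos (n := n) (j := j + 1) (by omega) (by omega)).ne'
  have hs : Real.sin ((j + 2 : ℕ) * (Real.pi / n)) =
      2 * Real.cos (Real.pi / n) * Real.sin ((j + 1 : ℕ) * (Real.pi / n)) -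
        Real.sin (j * (Real.pi / n)) := by
    have h₁ : ((j + 2 : ℕ) : ℝ) * (Real.pi / n) = ((j + 1 : ℕ) : ℝ) * (Real.pi / n) + Real.pi / n := by
      push_cast; ring
    have h₂ : (j : ℝ) * (Real.pi / n) = ((j + 1 : ℕ) : ℝ) * (Real.pi / n) - Real.pi / n := by
      push_cast; ring
    rw [h₁, h₂, Real.sin_add, Real.sin_sub]
    ring
  rw [poleOrbit, t, hs, eq_div_iff h]
  have := div_mul_cancel₀ (Real.sin (j * (Real.pi / n))) h
  linear_combination -this

/-- The pole of `B⁻¹` is `t`. Starting from the pole `1` of `B`, the backward orbit stays below `t`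
as long as the sines involved are positive. -/
lemma poleOrbit_lt_t {n j : ℕ} (hj : j + 2 < n) : poleOrbit n j < t n := by
  have h := t_sub_poleOrbit hj
  have := div_pos (sin_mul_pi_div_pos (n := n) (j := j + 2) (by omega) hj)
    (sin_mul_pi_div_pos (n := n) (j := j + 1) (by omega) (by omega))
  linarith

lemma poleOrbit_succ {n j : ℕ} (hj : j + 2 < n) :
    1 + 1 / (t n - poleOrbit n j) = poleOrbit n (j + 1) := by
  rw [t_sub_poleOrbit hj, poleOrbit, one_div_div]

lemma poleOrbit_zero (n : ℕ) : poleOrbit n 0 = 1 := by simp [poleOrbit]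

lemma poleOrbit_one {n : ℕ} (hn : 3 ≤ n) : poleOrbit n 1 = 1 + 1 / (t n - 1) := by
  have h := poleOrbit_succ (n := n) (j := 0) (by omega)
  rw [← h, poleOrbit_zero]

/-! ### Reading off digits -/

lemma coe_mem_interval {n : ℕ} {α x : ℝ} :
    (x : OnePoint ℝ) ∈ interval n α ↔ ell0 n α ≤ x ∧ x < r0 n α := by
  simp [interval]

lemma infty_notMem_interval {n : ℕ} {α : ℝ} : (∞ : OnePoint ℝ) ∉ interval n α := by
  simp [interval]

lemma cExp_eq {n : ℕ} {α : ℝ} {x : OnePoint ℝ} {l : ℕ} (hl : 1 ≤ l)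
    (h : C ^ l • x ∉ interval n α) (h' : ∀ j, 1 ≤ j → j < l → C ^ j • x ∈ interval n α) :
    cExp n α x = l := by
  refine le_antisymm (Nat.sInf_le ⟨hl, h⟩) (le_csInf ⟨l, hl, h⟩ ?_)
  rintro j ⟨hj, hj'⟩
  by_contra hlt
  exact hj' (h' j hj (not_le.mp hlt))

lemma r0_eq (n : ℕ) (α : ℝ) : r0 n α = ell0 n α + t n := by
  rw [r0, ell0]; ring

lemma aExp_eq {n : ℕ} (hn : 3 ≤ n) {α y : ℝ} {k : ℤ} (h : ell0 n α ≤ y + k * t n)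
    (h' : y + k * t n < r0 n α) : aExp n α y = k := by
  have ht : 0 < t n := by linarith [two_le_t hn]
  have e : y / t n + 1 - α = (y + t n - α * t n) / t n := by field_simp
  rw [aExp, OnePoint.elim_some, neg_eq_iff_eq_neg, Int.floor_eq_iff, e, le_div_iff₀ ht,
    div_lt_iff₀ ht]
  rw [ell0] at h
  rw [r0] at h'
  push_cast
  constructor <;> linarith

/-- The `T_α`-orbit of `x` has first digits `ds`, and arrives at `y` after them. -/
def Follows (n : ℕ) (α : ℝ) (x : OnePoint ℝ) (ds : List (ℤ × ℕ)) (y : OnePoint ℝ) : Prop :=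
  (T n α)^[ds.length] x = y ∧
    (List.range ds.length).map (fun j => digit n α ((T n α)^[j] x)) = ds.map some

lemma Follows.nil (n : ℕ) (α : ℝ) (x : OnePoint ℝ) : Follows n α x [] x := by simp [Follows]

lemma Follows.append {n : ℕ} {α : ℝ} {x y w : OnePoint ℝ} {d e : List (ℤ × ℕ)}
    (h : Follows n α x d y) (h' : Follows n α y e w) : Follows n α x (d ++ e) w := by
  constructor
  · rw [List.length_append, add_comm, Function.iterate_add_apply, h.1, h'.1]
  · rw [List.length_append, List.range_add, List.map_append, List.map_append, h.2, ← h'.2,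
      List.map_map]
    congr 1
    apply List.map_congr_left
    intro j _
    simp only [Function.comp_apply]
    rw [add_comm, Function.iterate_add_apply, h.1]

lemma Follows.cons {n : ℕ} {α : ℝ} {x y w : OnePoint ℝ} {d : ℤ × ℕ} {e : List (ℤ × ℕ)}
    (h : Follows n α x [d] y) (h' : Follows n α y e w) : Follows n α x (d :: e) w :=
  h.append h'

lemma wpow_succ {β : Type*} (w : List β) (q : ℕ) : wpow w (q + 1) = w ++ wpow w q := by
  simp [wpow, List.replicate_succ]

lemma wpow_zero {β : Type*} (w : List β) : wpow w 0 = [] := rfl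

/-- Because `𝕀_α` has length exactly `t`, a point that a nonzero translation by `k t` brings into
`𝕀_α` lies outside it. This certifies at once that `l` is the exponent of `C` and `k` that of `A`.
-/
lemma Follows.step {n : ℕ} (hn : 3 ≤ n) {α : ℝ} {x : OnePoint ℝ} {l : ℕ} {k : ℤ} {y p : ℝ}
    (hl : 1 ≤ l) (hx : x ≠ ∞) (hy : C ^ l • x = (y : OnePoint ℝ))
    (hin : ∀ j, 1 ≤ j → j < l → C ^ j • x ∈ interval n α) (hk : k ≠ 0)
    (hp : y + k * t n = p) (h₁ : ell0 n α ≤ p) (h₂ : p < r0 n α) :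
    Follows n α x [(k, l)] p := by
  have ht : 0 < t n := by linarith [two_le_t hn]
  subst hp
  have hout : C ^ l • x ∉ interval n α := by
    rw [hy, coe_mem_interval, r0_eq]
    rw [r0_eq] at h₂
    rintro ⟨h₃, h₄⟩
    rcases lt_or_gt_of_ne hk with hk | hk
    · have : (k : ℝ) ≤ -1 := by exact_mod_cast (by omega : k ≤ -1)
      nlinarith
    · have : (1 : ℝ) ≤ k := by exact_mod_cast (by omega : 1 ≤ k)
      nlinarith
  have hc := cExp_eq hl hout hin
  have ha := aExp_eq hn h₁ h₂
  have hT : T n α x = ((y + k * t n : ℝ) : OnePoint ℝ) := by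
    rw [T, if_neg hx, hc, hy, ha, A_zpow_smul]
  have hd : digit n α x = some (k, l) := by
    rw [digit, hT, if_neg (OnePoint.coe_ne_infty _), hc, hy, ha]
  constructor
  · simpa using hT
  · simpa using hd

lemma Follows.step_one {n : ℕ} (hn : 3 ≤ n) {α x p : ℝ} {k : ℤ} (hx : x ≠ 0) (hk : k ≠ 0)
    (hp : 1 - 1 / x + k * t n = p) (h₁ : ell0 n α ≤ p) (h₂ : p < r0 n α) :
    Follows n α x [(k, 1)] p :=
  Follows.step hn le_rfl (OnePoint.coe_ne_infty _) (by rw [pow_one, C_smul hx])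
    (fun j hj hj' => by omega) hk hp h₁ h₂

/-- For `x > 1` the point `C · x = 1 - 1/x` is in `(0, 1)`, inside `𝕀_α`; this is what makes the
exponent of `C` equal to `2`. -/
lemma Follows.step_two {n : ℕ} (hn : 3 ≤ n) {α x p : ℝ} (hx : 1 < x)
    (hr : 1 ≤ r0 n α) (hl : ell0 n α ≤ 0)
    (hp : 1 / (1 - x) + t n = p) (h₁ : ell0 n α ≤ p) (h₂ : p < r0 n α) :
    Follows n α x [(1, 2)] p := by
  refine Follows.step hn (k := 1) one_le_two (OnePoint.coe_ne_infty _) (C_sq_smul hx.ne')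
    ?_ one_ne_zero (by simpa using hp) h₁ h₂
  intro j hj hj'
  obtain rfl : j = 1 := by omega
  have hx0 : 0 < x := by linarith
  rw [pow_one, C_smul hx0.ne', coe_mem_interval]
  have : 0 < 1 / x := by positivity
  have : 1 / x < 1 := by rw [div_lt_one hx0]; exact hx
  constructor <;> linarith

/-! ### Blocks of digits of the right orbit -/

/-- The map `(A C²)⁻¹`, that is `x ↦ 1 + 1 / (t - x)`. -/
noncomputable def invB (n : ℕ) (x : ℝ) : ℝ := 1 + 1 / (t n - x)

lemma B_smul_coe (n : ℕ) {x : ℝ} (hx : x ≠ 1) :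
    B n • (x : OnePoint ℝ) = ((t n + 1 / (1 - x) : ℝ) : OnePoint ℝ) := by
  rw [B, mul_smul, C_sq_smul hx, A_smul, add_comm]

lemma B_inv_smul_coe (n : ℕ) {x : ℝ} (hx : x ≠ t n) :
    (B n)⁻¹ • (x : OnePoint ℝ) = ((invB n x : ℝ) : OnePoint ℝ) := by
  have h : t n - x ≠ 0 := sub_ne_zero.mpr hx.symm
  rw [inv_smul_eq_iff, B_smul_coe, invB]
  · congr 1
    field_simp
    ring
  · rw [invB]
    intro h'
    have : 1 / (t n - x) ≠ 0 := one_div_ne_zero h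
    apply this
    linarith

lemma invB_lt_poleOrbit {n j : ℕ} {x : ℝ} (hj : j + 2 < n) (hx : x < poleOrbit n j) :
    invB n x < poleOrbit n (j + 1) := by
  have h := poleOrbit_lt_t hj
  rw [← poleOrbit_succ hj, invB]
  gcongr

lemma lt_invB {n : ℕ} (hn : 3 ≤ n) {x : ℝ} (hx : x < t n) : x < invB n x := by
  have h₁ := t_lt_three hn
  have h₂ := two_le_t hn
  have h : 0 < t n - x := by linarith
  rw [invB, ← sub_lt_iff_lt_add', lt_div_iff₀ h]
  -- The claim is `(x - 1)(t - x) < 1`; by the arithmetic–geometric mean the product is at most `(t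
  -- - 1)² / 4`, which is below `1` as `t < 3`.
  nlinarith [sq_nonneg ((x - 1) - (t n - x))]

lemma one_lt_invB {n : ℕ} {x : ℝ} (hx : x < t n) : 1 < invB n x := by
  have h : 0 < t n - x := by linarith
  rw [invB]
  have : 0 < 1 / (t n - x) := by positivity
  linarith

lemma iterate_invB_lt_poleOrbit {n j N : ℕ} {x : ℝ} (hj : j + N + 1 < n)
    (hx : x < poleOrbit n j) : (invB n)^[N] x < poleOrbit n (j + N) := by
  induction N with
  | zero => simpa using hx
  | succ N ih =>
    rw [Function.iterate_succ_apply']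
    exact invB_lt_poleOrbit (by omega) (ih (by omega))

lemma B_inv_pow_smul {n j N : ℕ} {x : ℝ} (hj : j + N + 1 < n) (hx : x < poleOrbit n j) :
    (B n)⁻¹ ^ N • (x : OnePoint ℝ) = (((invB n)^[N] x : ℝ) : OnePoint ℝ) := by
  induction N with
  | zero => simp
  | succ N ih =>
    have h := (iterate_invB_lt_poleOrbit (N := N) (by omega) hx).trans (poleOrbit_lt_t (by omega))
    rw [pow_succ', mul_smul, ih (by omega), B_inv_smul_coe n h.ne, Function.iterate_succ_apply']

/-- The digit `(1,2)` acts as `B`, so the run is built backwards from its end `x`. Going backwards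
increases the points, hence only the highest one has to be compared with `r₀`; the bound by
`poleOrbit` keeps every backward step away from the pole `t`. -/
lemma Follows.chain {n : ℕ} (hn : 3 ≤ n) {α x : ℝ} {j N : ℕ} (hj : j + N + 1 < n)
    (hx : x < poleOrbit n j) (hlow : 0 ≤ x) (hr : 1 ≤ r0 n α) (hl : ell0 n α ≤ 0)
    (htop : (invB n)^[N] x ≤ r0 n α) :
    Follows n α (((invB n)^[N] x : ℝ) : OnePoint ℝ) (wpow [(1, 2)] N) (x : OnePoint ℝ) := by
  induction N with
  | zero => exact Follows.nil n α _
  | succ N ih =>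
    have h := (iterate_invB_lt_poleOrbit (N := N) (by omega) hx).trans (poleOrbit_lt_t (by omega))
    rw [Function.iterate_succ_apply'] at htop ⊢
    have hlt := lt_invB hn h
    have hne : t n - (invB n)^[N] x ≠ 0 := by linarith
    have hpos : 0 ≤ (invB n)^[N] x := by
      rcases N with _ | N
      · exact hlow
      · rw [Function.iterate_succ_apply']
        exact le_trans zero_le_one (one_lt_invB ((iterate_invB_lt_poleOrbit (N := N) (by omega)
          hx).trans (poleOrbit_lt_t (by omega)))).le
    rw [wpow_succ]
    refine Follows.append (Follows.step_two hn (one_lt_invB h) hr hl ?_ (hl.trans hpos)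
      (hlt.trans_le htop)) (ih (by omega) (hlt.le.trans htop))
    rw [invB]
    field_simp
    ring

/-- The point `A C² · q` for `q = Q`, that is `t - 1 / (Q - 1)`. -/
noncomputable def topPoint (n : ℕ) (Q : ℝ) : ℝ := t n - 1 / (Q - 1)

/-- The point `M⁻¹ · (-s)` of the right orbit that corresponds to the point `-s` of the
left orbit. -/
noncomputable def mirror (n : ℕ) (s : ℝ) : ℝ := 1 - s / (1 - (t n - 1) * s)

lemma M_inv_smul (n : ℕ) {s : ℝ} (hs : (t n - 1) * s < 1) :
    (M n)⁻¹ • ((-s : ℝ) : OnePoint ℝ) = (mirror n s : OnePoint ℝ) := by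
  rw [M_inv, mul_smul, mul_smul, mirror]
  by_cases h : s = 0
  · subst h
    rw [neg_zero, C_smul_zero, A_inv_smul_infty, C_smul_infty]
    simp
  · rw [C_smul (neg_ne_zero.mpr h), A_inv_smul]
    have h' : 1 - (t n - 1) * s ≠ 0 := by linarith
    have e : 1 - 1 / (-s) - t n = (1 - (t n - 1) * s) / s := by
      field_simp
      ring
    rw [e, C_smul (div_ne_zero h' h), one_div_div]

lemma B_pow_three_smul_mirror (n : ℕ) {s : ℝ} (hs : (t n - 1) * s < 1) (hs' : s < t n - 1) :
    B n ^ 3 • (mirror n s : OnePoint ℝ) = (topPoint n (t n - s) : OnePoint ℝ) := by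
  have e : B n ^ 3 * (M n)⁻¹ = B n * A n := by
    rw [M_inv, B, ← C_inv, pow_succ, pow_two]
    group
  rw [← M_inv_smul n hs, smul_smul, e, mul_smul, A_smul, B_smul_coe, topPoint]
  · congr 1
    rw [← neg_div_neg_eq, neg_sub]
    ring
  · linarith

lemma B_sq_smul {n : ℕ} {Q : ℝ} (hQ : 0 < Q) (ht : 1 < t n) :
    B n ^ 2 • ((1 - 1 / Q : ℝ) : OnePoint ℝ) = (topPoint n (Q + t n) : OnePoint ℝ) := by
  have h : 1 / Q ≠ 0 := by positivity
  rw [pow_two, mul_smul, B_smul_coe, sub_sub_cancel, one_div_one_div, B_smul_coe, topPoint]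
  · congr 1
    rw [← neg_div_neg_eq, neg_sub]
    ring
  · linarith
  · intro h'
    apply h
    linarith

section Blocks

variable {n : ℕ} {α z : ℝ}

lemma one_le_r0 (hn : 3 ≤ n) (hα : ell0 n α = -z) (hz : t n * z ≤ 1) : 1 ≤ r0 n α := by
  have := two_le_t hn
  rw [r0_eq, hα]
  nlinarith

/-- Here `A C · (1 - 1/Q) = t - 1/(Q - 1)`. The upper bound on `Q` says exactly that this is below
`r₀ = t - z`; the lower bound gives `Q - 1 ≥ 1/2`, enough to stay above `ℓ₀`. -/
lemma Follows.one_one (hn : 3 ≤ n) (hα : ell0 n α = -z) (hz₀ : 0 < z) (hz : t n * z ≤ 1)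
    {Q : ℝ} (hQ : t n - z ≤ Q) (hQ' : Q < 1 + 1 / z) :
    Follows n α ((1 - 1 / Q : ℝ) : OnePoint ℝ) [(1, 1)] (topPoint n Q : OnePoint ℝ) := by
  have ht := two_le_t hn
  have hz' : z ≤ 1 / 2 := by nlinarith
  have hQ1 : 1 / 2 ≤ Q - 1 := by linarith
  have hQ0 : Q ≠ 0 := by intro h; linarith
  have hQ2 : Q - 1 ≠ 0 := by intro h; linarith
  have e : 1 - 1 / Q = (Q - 1) / Q := by field_simp
  refine Follows.step_one hn ?_ one_ne_zero ?_ ?_ ?_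
  · rw [e]
    exact div_ne_zero hQ2 hQ0
  · rw [e, topPoint]
    field_simp
    push_cast
    ring
  · have : 1 / (Q - 1) ≤ 2 := by
      rw [div_le_iff₀ (by linarith)]
      linarith
    rw [hα, topPoint]
    linarith
  · have : z < 1 / (Q - 1) := by
      rw [lt_div_iff₀ (by linarith), mul_comm, ← lt_div_iff₀ hz₀]
      linarith
    rw [r0_eq, hα, topPoint]
    linarith

lemma topPoint_le_r0 (hα : ell0 n α = -z) (hz₀ : 0 < z) {Q : ℝ} (hQ₁ : 1 < Q)
    (hQ : Q ≤ 1 + 1 / z) : topPoint n Q ≤ r0 n α := by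
  have : z ≤ 1 / (Q - 1) := by
    rw [le_div_iff₀ (by linarith), mul_comm, ← le_div_iff₀ hz₀]
    linarith
  rw [r0_eq, hα, topPoint]
  linarith

/-- The run acts as `B ^ (n-2) = ±B⁻²`, and `B²` takes `1 - 1/Q` to the starting point. -/
lemma Follows.one_two_pow (hn : 3 ≤ n) (hα : ell0 n α = -z) (hz₀ : 0 < z) (hz : t n * z ≤ 1)
    {Q : ℝ} (hQ : t n - z ≤ Q) (hQ' : Q + t n ≤ 1 + 1 / z) :
    Follows n α (topPoint n (Q + t n) : OnePoint ℝ) (wpow [(1, 2)] (n - 2))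
      ((1 - 1 / Q : ℝ) : OnePoint ℝ) := by
  have ht := two_le_t hn
  have hz' : z ≤ 1 / 2 := by nlinarith
  have hQ0 : 0 < Q := by linarith
  have hx : 1 - 1 / Q < poleOrbit n 0 := by
    rw [poleOrbit_zero]
    have : 0 < 1 / Q := by positivity
    linarith
  have e : (invB n)^[n - 2] (1 - 1 / Q) = topPoint n (Q + t n) := by
    rw [← OnePoint.coe_eq_coe, ← B_inv_pow_smul (by omega) hx,
      (B_inv_pow hn (i := n - 2) (j := 2) (by omega)).smul_eq, B_sq_smul hQ0 (by linarith)]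
  rw [← e]
  refine Follows.chain hn (by omega) hx ?_ (one_le_r0 hn hα hz) (by linarith) ?_
  · rw [sub_nonneg, div_le_one hQ0]
    linarith
  · rw [e]
    exact topPoint_le_r0 hα hz₀ (by linarith) hQ'

/-- Each word `u` lowers the parameter `Q` by `t`, reflecting that `U` is conjugate to `A⁻¹`. -/
lemma Follows.uWord (hn : 3 ≤ n) (hα : ell0 n α = -z) (hz₀ : 0 < z) (hz : t n * z ≤ 1)
    {Q : ℝ} (m : ℕ) (hQ : t n - z ≤ Q) (hQ' : Q + m * t n < 1 + 1 / z) :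
    Follows n α (topPoint n (Q + m * t n) : OnePoint ℝ) (wpow (uWord n) m)
      (topPoint n Q : OnePoint ℝ) := by
  have ht := two_le_t hn
  induction m with
  | zero => simpa [wpow_zero] using Follows.nil n α _
  | succ m ih =>
    have e : Q + (m + 1 : ℕ) * t n = Q + m * t n + t n := by push_cast; ring
    have hm : (0 : ℝ) ≤ m * t n := by positivity
    rw [e] at hQ' ⊢
    rw [wpow_succ, TriangleCF.uWord]
    exact ((Follows.one_two_pow hn hα hz₀ hz (by linarith) hQ'.le).append
      (Follows.one_one hn hα hz₀ hz (by linarith) (by linarith))).append (ih (by linarith))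

lemma mirror_eq {s : ℝ} (hs : s ≠ 0) (hs' : (t n - 1) * s < 1) :
    mirror n s = 1 - 1 / (1 + 1 / s - t n) := by
  have h : 1 - (t n - 1) * s ≠ 0 := by linarith
  have e : 1 + 1 / s - t n = (1 - (t n - 1) * s) / s := by
    field_simp
    ring
  rw [e, one_div_div, mirror]

lemma mirror_lt (hn : 3 ≤ n) {s : ℝ} (hs : t n * s ≤ 1) : mirror n s < 1 + 1 / (t n - 1) := by
  have ht := two_le_t hn
  have hs₁ : 0 < 1 - (t n - 1) * s := by nlinarith
  have : 0 < 1 / ((t n - 1) * (1 - (t n - 1) * s)) :=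
    one_div_pos.mpr (mul_pos (by linarith) hs₁)
  have e : 1 + 1 / (t n - 1) - mirror n s = 1 / ((t n - 1) * (1 - (t n - 1) * s)) := by
    rw [mirror]
    have : t n - 1 ≠ 0 := by linarith
    field_simp
    ring
  linarith

lemma sub_one_mul_lt_one (hn : 3 ≤ n) {s : ℝ} (hs : t n * s ≤ 1) : (t n - 1) * s < 1 := by
  have := two_le_t hn
  nlinarith

lemma mirror_nonneg (hn : 3 ≤ n) {s : ℝ} (hs : t n * s ≤ 1) : 0 ≤ mirror n s := by
  have ht := two_le_t hn
  have hs₁ : 0 < 1 - (t n - 1) * s := by nlinarith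
  rw [mirror, sub_nonneg, div_le_one hs₁]
  linarith

/-- With `Q = 1 + 1/s - t = (t - s') + m t`, the start is `1 - 1/Q`. The digit `(1,1)` leads to
`topPoint n Q`, the `m` words `u` bring `Q` down to `t - s'`, and the last run, acting as `±B⁻³`,
ends at `mirror n s'`. The hypothesis `hlow` is `Q < 1 + 1/z`. -/
lemma Follows.block (hn : 3 ≤ n) (hα : ell0 n α = -z) (hz₀ : 0 < z) (hz : t n * z ≤ 1)
    {s s' : ℝ} (m : ℕ) (hs₀ : 0 < s) (hs : t n * s ≤ 1) (hs' : s' ≤ z)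
    (hss' : 1 + 1 / s - (m + 2) * t n = -s') (hlow : 1 / s < t n + 1 / z) :
    Follows n α (mirror n s : OnePoint ℝ)
      ([(1, 1)] ++ wpow (TriangleCF.uWord n) m ++ wpow [(1, 2)] (n - 3))
      (mirror n s' : OnePoint ℝ) := by
  have ht := two_le_t hn
  have ht' := t_lt_three hn
  have hz' : z ≤ 1 / 2 := by nlinarith
  have hts' : t n * s' ≤ 1 := (mul_le_mul_of_nonneg_left hs' (by linarith)).trans hz
  have hm : (0 : ℝ) ≤ m * t n := by positivity
  have e : 1 + 1 / s - t n = (t n - s') + m * t n := by linarith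
  have hx : mirror n s' < poleOrbit n 1 := by
    rw [poleOrbit_one hn]
    exact mirror_lt hn hts'
  have etop : (invB n)^[n - 3] (mirror n s') = topPoint n (t n - s') := by
    rw [← OnePoint.coe_eq_coe, ← B_inv_pow_smul (j := 1) (by omega) hx,
      (B_inv_pow hn (i := n - 3) (j := 3) (by omega)).smul_eq,
      B_pow_three_smul_mirror n (sub_one_mul_lt_one hn hts') (by linarith)]
  refine Follows.append (Follows.append (y := (topPoint n ((t n - s') + m * t n) : OnePoint ℝ))
    ?_ ?_) ?_ (y := (topPoint n (t n - s') : OnePoint ℝ))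
  · rw [mirror_eq hs₀.ne' (sub_one_mul_lt_one hn hs), e]
    exact Follows.one_one hn hα hz₀ hz (by linarith) (by linarith)
  · exact Follows.uWord hn hα hz₀ hz m (by linarith) (by linarith)
  · rw [← etop]
    refine Follows.chain hn (j := 1) (by omega) hx (mirror_nonneg hn hts') (one_le_r0 hn hα hz)
      (by linarith) ?_
    rw [etop]
    exact topPoint_le_r0 hα hz₀ (by linarith) (by linarith)

end Blocks

/-! ### Binary words -/

/-- The binary word of `c₁ d₁ c₂ ⋯`: runs of lengths `c₁, d₁, c₂, …` of the letter `b` and of its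
negation in turn. -/
def letters : Bool → List ℕ → List Bool
  | _, [] => []
  | b, c :: w => List.replicate c b ++ letters (!b) w

/-- The product of the matrices of the letters, in the reversed order. -/
def wordProd {G : Type*} [Group G] (f : Bool → G) : List Bool → G
  | [] => 1
  | c :: l => wordProd f l * f c

lemma wordProd_append {G : Type*} [Group G] (f : Bool → G) (l l' : List Bool) :
    wordProd f (l ++ l') = wordProd f l' * wordProd f l := by
  induction l with
  | nil => simp [wordProd]
  | cons c l ih => rw [List.cons_append, wordProd, ih, wordProd, mul_assoc]

lemma wordProd_replicate {G : Type*} [Group G] (f : Bool → G) (b : Bool) (c : ℕ) :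
    wordProd f (List.replicate c b) = f b ^ c := by
  induction c with
  | zero => simp [wordProd]
  | succ c ih => rw [List.replicate_succ, wordProd, ih, pow_succ]

lemma expandMul_eq_wordProd {G : Type*} [Group G] (f : Bool → G) (b : Bool) (v : List ℕ) :
    expandMul (f b) (f (!b)) v = wordProd f (letters b v) := by
  induction v generalizing b with
  | nil => rfl
  | cons c w ih =>
    have h := ih (!b)
    rw [Bool.not_not] at h
    rw [expandMul, letters, wordProd_append, wordProd_replicate, h]

lemma expand_eq_flatMap {β : Type*} (f : Bool → List β) (b : Bool) (v : List ℕ) :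
    expand (f b) (f (!b)) v = (letters b v).flatMap f := by
  induction v generalizing b with
  | nil => rfl
  | cons c w ih =>
    have h := ih (!b)
    rw [Bool.not_not] at h
    rw [expand, letters, List.flatMap_append, h, List.flatMap_replicate, wpow]

lemma length_letters (b : Bool) (v : List ℕ) : (letters b v).length = v.sum := by
  induction v generalizing b with
  | nil => rfl
  | cons c w ih => rw [letters, List.length_append, List.length_replicate, ih, List.sum_cons]

/-- At the first position where `s` and `x` differ, `s` has `hi` and `x` has `lo`. -/
def FirstDiff (hi lo : Bool) (s x : List Bool) : Prop :=
  ∃ c s' x', s = c ++ hi :: s' ∧ x = c ++ lo :: x'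

/-- The combinatorial condition under which the digits of the two orbits can be controlled. -/
def Admissible (ω : List Bool) : Prop :=
  (∃ τ, ω = true :: τ ∧ ∀ s, (false :: s) <:+ ω → FirstDiff true false s τ) ∧
    ∀ s, s <:+ ω → s <+: ω ∨ FirstDiff true false ω s

/-! ### Inverse branches of the left orbit -/

/-- The matrix `A ^ (-k) C` or `A ^ (-k-1) C` of a letter. -/
noncomputable def letterMat (n k : ℕ) (c : Bool) : GL (Fin 2) ℝ :=
  if c then A n ^ (-(k : ℤ)) * C else A n ^ (-(k : ℤ) - 1) * C

/-- The inverse of the action of `letterMat n k c`, in the coordinate `-x`. -/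
noncomputable def invBranch (n k : ℕ) (c : Bool) (w : ℝ) : ℝ :=
  1 / ((if c then (k : ℝ) else k + 1) * t n - 1 - w)

/-- The composition of the inverse branches of the letters of a word. -/
noncomputable def val (n k : ℕ) (w : ℝ) (l : List Bool) : ℝ := l.foldr (invBranch n k) w

section Values

variable {n k : ℕ}

@[simp] lemma val_nil (w : ℝ) : val n k w [] = w := rfl

@[simp] lemma val_cons (w : ℝ) (c : Bool) (l : List Bool) :
    val n k w (c :: l) = invBranch n k c (val n k w l) := rfl

lemma val_append (w : ℝ) (l l' : List Bool) :
    val n k w (l ++ l') = val n k (val n k w l') l := by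
  rw [val, List.foldr_append, val, val]

/-- From `t ≥ 2` and `t w ≤ 1` comes `w ≤ 1/2`, and then `2t - 1 - w ≥ t`. This makes `t w ≤ 1` an
invariant of the inverse branches, and denominators of at least `2` yield the contraction ratio
`1/4`. -/
lemma le_denom (hn : 3 ≤ n) (hk : 2 ≤ k) {w : ℝ} (hw : t n * w ≤ 1) (c : Bool) :
    t n ≤ (if c then (k : ℝ) else k + 1) * t n - 1 - w := by
  have ht := two_le_t hn
  have hk' : (2 : ℝ) ≤ k := by exact_mod_cast hk
  have : w ≤ 1 / 2 := by nlinarith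
  split_ifs <;> nlinarith

lemma invBranch_pos (hn : 3 ≤ n) (hk : 2 ≤ k) {w : ℝ} (hw : t n * w ≤ 1) (c : Bool) :
    0 < invBranch n k c w :=
  one_div_pos.mpr (by linarith [le_denom hn hk hw c, two_le_t hn])

lemma mul_invBranch_le (hn : 3 ≤ n) (hk : 2 ≤ k) {w : ℝ} (hw : t n * w ≤ 1) (c : Bool) :
    t n * invBranch n k c w ≤ 1 := by
  have h := le_denom hn hk hw c
  have ht := two_le_t hn
  rw [invBranch, mul_one_div, div_le_one (by linarith)]
  exact h

lemma invBranch_lt (hn : 3 ≤ n) (hk : 2 ≤ k) {u u' : ℝ} (hu' : t n * u' ≤ 1) (h : u < u')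
    (c : Bool) : invBranch n k c u < invBranch n k c u' := by
  have h' := le_denom hn hk hu' c
  have ht := two_le_t hn
  exact one_div_lt_one_div_of_lt (by linarith) (by linarith)

lemma invBranch_false_lt_true (hn : 3 ≤ n) (hk : 2 ≤ k) {u u' : ℝ} (hu : t n * u ≤ 1)
    (h : u' - u < t n) : invBranch n k false u' < invBranch n k true u := by
  have h' := le_denom hn hk hu true
  have ht := two_le_t hn
  simp only [invBranch, if_true, Bool.false_eq_true, if_false] at h' ⊢
  exact one_div_lt_one_div_of_lt (by linarith) (by linarith)

lemma invBranch_sub_le (hn : 3 ≤ n) (hk : 2 ≤ k) {u u' : ℝ} (hu' : t n * u' ≤ 1) (h : u ≤ u')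
    (c : Bool) : invBranch n k c u' - invBranch n k c u ≤ (u' - u) / 4 := by
  have h' := le_denom hn hk hu' c
  have ht := two_le_t hn
  rw [invBranch, invBranch]
  set a := (if c then (k : ℝ) else k + 1) * t n - 1
  have h₁ : 2 ≤ a - u' := by linarith
  have h₂ : 2 ≤ a - u := by linarith
  rw [div_sub_div _ _ (by linarith) (by linarith), div_le_div_iff₀ (by nlinarith) (by norm_num)]
  nlinarith [mul_nonneg (sub_nonneg.mpr h) (by nlinarith : 0 ≤ (a - u') * (a - u) - 4)]

lemma mul_val_le (hn : 3 ≤ n) (hk : 2 ≤ k) {w : ℝ} (hw : t n * w ≤ 1) (l : List Bool) :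
    t n * val n k w l ≤ 1 := by
  induction l with
  | nil => exact hw
  | cons c l ih => exact mul_invBranch_le hn hk ih c

lemma val_pos (hn : 3 ≤ n) (hk : 2 ≤ k) {w : ℝ} (hw : t n * w ≤ 1) {l : List Bool} (hl : l ≠ []) :
    0 < val n k w l := by
  cases l with
  | nil => exact absurd rfl hl
  | cons c l => exact invBranch_pos hn hk (mul_val_le hn hk hw l) c

lemma val_lt_val (hn : 3 ≤ n) (hk : 2 ≤ k) {u u' : ℝ} (hu' : t n * u' ≤ 1) (h : u < u')
    (l : List Bool) : val n k u l < val n k u' l := by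
  induction l with
  | nil => exact h
  | cons c l ih => exact invBranch_lt hn hk (mul_val_le hn hk hu' l) ih c

lemma val_le_val (hn : 3 ≤ n) (hk : 2 ≤ k) {u u' : ℝ} (hu' : t n * u' ≤ 1) (h : u ≤ u')
    (l : List Bool) : val n k u l ≤ val n k u' l := by
  rcases h.eq_or_lt with rfl | h
  · exact le_rfl
  · exact (val_lt_val hn hk hu' h l).le

lemma val_sub_le (hn : 3 ≤ n) (hk : 2 ≤ k) {u u' : ℝ} (hu' : t n * u' ≤ 1) (h : u ≤ u')
    (l : List Bool) : val n k u' l - val n k u l ≤ u' - u := by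
  induction l with
  | nil => exact le_rfl
  | cons c l ih =>
    have := invBranch_sub_le hn hk (mul_val_le hn hk hu' l) (val_le_val hn hk hu' h l) c
    simp only [val_cons]
    linarith

lemma val_sub_le_div (hn : 3 ≤ n) (hk : 2 ≤ k) {u u' : ℝ} (hu' : t n * u' ≤ 1) (h : u ≤ u')
    {l : List Bool} (hl : l ≠ []) : val n k u' l - val n k u l ≤ (u' - u) / 4 := by
  cases l with
  | nil => exact absurd rfl hl
  | cons c l =>
    have := invBranch_sub_le hn hk (mul_val_le hn hk hu' l) (val_le_val hn hk hu' h l) c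
    have := val_sub_le hn hk hu' h l
    simp only [val_cons]
    linarith

/-- Values follow the lexicographic order: changing a letter moves the denominator by `t`, which
outweighs any difference of the tails below `t`. -/
lemma val_lt_of_firstDiff (hn : 3 ≤ n) (hk : 2 ≤ k) {w : ℝ} (hw : t n * w ≤ 1)
    (c s x : List Bool) (h : val n k w x - val n k w s < t n) :
    val n k w (c ++ false :: x) < val n k w (c ++ true :: s) := by
  rw [val_append, val_append]
  exact val_lt_val hn hk (mul_val_le hn hk hw _)
    (invBranch_false_lt_true hn hk (mul_val_le hn hk hw s) h) c

lemma letterMat_smul (hn : 3 ≤ n) (hk : 2 ≤ k) {w : ℝ} (hw : t n * w ≤ 1) (c : Bool) :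
    letterMat n k c • ((-invBranch n k c w : ℝ) : OnePoint ℝ) = ((-w : ℝ) : OnePoint ℝ) := by
  have h := invBranch_pos hn hk hw c
  have e : 1 - 1 / (-invBranch n k c w) = (if c then (k : ℝ) else k + 1) * t n - w := by
    rw [one_div_neg_eq_neg_one_div, invBranch, one_div_one_div]
    ring
  cases c
  · rw [letterMat, if_neg (by simp), mul_smul, C_smul (by linarith), A_zpow_smul, e]
    congr 1
    push_cast
    ring
  · rw [letterMat, if_pos rfl, mul_smul, C_smul (by linarith), A_zpow_smul, e, if_pos rfl]
    congr 1
    push_cast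
    ring

lemma wordProd_smul_val (hn : 3 ≤ n) (hk : 2 ≤ k) {w : ℝ} (hw : t n * w ≤ 1) (l : List Bool) :
    wordProd (letterMat n k) l • ((-val n k w l : ℝ) : OnePoint ℝ) = ((-w : ℝ) : OnePoint ℝ) := by
  induction l with
  | nil => simp [wordProd]
  | cons c l ih =>
    rw [wordProd, mul_smul, val_cons, letterMat_smul hn hk (mul_val_le hn hk hw l), ih]

lemma wordProd_smul_eq_iff (hn : 3 ≤ n) (hk : 2 ≤ k) {w z : ℝ} (hw : t n * w ≤ 1)
    (l : List Bool) :
    wordProd (letterMat n k) l • ((-z : ℝ) : OnePoint ℝ) = ((-w : ℝ) : OnePoint ℝ) ↔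
      val n k w l = z := by
  rw [← wordProd_smul_val hn hk hw l, smul_left_cancel_iff, OnePoint.coe_eq_coe, neg_inj, eq_comm]

/-- The lower end of the values of the suffixes: the value of the word whose first letter has
been changed. -/
noncomputable def lowEnd (n : ℕ) (z : ℝ) : ℝ := z / (t n * z + 1)

lemma mul_lowEnd_le (hn : 3 ≤ n) {z : ℝ} (hz : 0 ≤ z) : t n * lowEnd n z ≤ 1 := by
  have ht := two_le_t hn
  have : 0 < t n * z + 1 := by positivity
  rw [lowEnd, ← mul_div_assoc, div_le_one this]
  linarith

lemma lowEnd_eq (hn : 3 ≤ n) (hk : 2 ≤ k) {u : ℝ} (hu : t n * u ≤ 1) :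
    lowEnd n (invBranch n k true u) = invBranch n k false u := by
  have h := le_denom hn hk hu true
  have h' := le_denom hn hk hu false
  have ht := two_le_t hn
  simp only [if_true, Bool.false_eq_true, if_false] at h h'
  simp only [lowEnd, invBranch, if_true, Bool.false_eq_true, if_false]
  have h₁ : (k : ℝ) * t n - 1 - u ≠ 0 := by linarith
  have h₂ : ((k : ℝ) + 1) * t n - 1 - u ≠ 0 := by linarith
  have h₃ : t n * (1 / (k * t n - 1 - u)) + 1 = ((k + 1) * t n - 1 - u) / (k * t n - 1 - u) := by
    rw [eq_div_iff h₁, add_mul, mul_assoc, one_div_mul_cancel h₁]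
    ring
  rw [h₃]
  field_simp

/-- All nonempty suffixes of an admissible word take their values in `(lowEnd n z, z]`. -/
theorem val_suffix_bounds (hn : 3 ≤ n) (hk : 2 ≤ k) {ω : List Bool} (hω : Admissible ω)
    {w z : ℝ} (hval : val n k w ω = z) (hw : t n * w ≤ 1) (hw₁ : z - t n < w)
    (hw₂ : w ≤ lowEnd n z) {s : List Bool} (hs : s <:+ ω) (hs₀ : s ≠ []) :
    lowEnd n z < val n k w s ∧ val n k w s ≤ z := by
  have ht := two_le_t hn
  obtain ⟨⟨τ, rfl, hlow⟩, hup⟩ := hω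
  have hle : ∀ l, val n k w l ≤ 1 / 2 := fun l => by nlinarith [mul_val_le hn hk hw l]
  have hpos : ∀ l, l ≠ [] → 0 < val n k w l := fun l hl => val_pos hn hk hw hl
  have hlowEnd : lowEnd n z = invBranch n k false (val n k w τ) := by
    rw [← hval, val_cons, lowEnd_eq hn hk (mul_val_le hn hk hw τ)]
  -- A final letter `false` would require the empty word to exceed `τ` at a common position.
  have hend : ∀ c, ¬ (c ++ [false]) <:+ true :: τ := by
    intro c hc
    obtain ⟨c', s', x', h, -⟩ := hlow [] ((List.suffix_append c [false]).trans hc)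
    simp at h
  -- If `s` is a prefix of `ω = s r`, then `z` and the value of `s` differ only in having the value
  -- of `r` or `w` innermost; hence the requirement `w ≤ val n k w r`.
  have upper : (∀ r, r <:+ true :: τ → r ≠ [] → w ≤ val n k w r) →
      ∀ s, s <:+ true :: τ → s ≠ [] → val n k w s ≤ z := by
    intro tie s hs hs₀
    rcases hup s hs with ⟨r, hr⟩ | ⟨c, x, s', hx, rfl⟩
    · by_cases hr₀ : r = []
      · rw [hr₀, List.append_nil] at hr
        rw [hr, hval]
      · have := tie r ⟨s, hr⟩ hr₀
        rw [← hval, ← hr, val_append]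
        exact val_le_val hn hk (mul_val_le hn hk hw r) this s
    · rw [← hval, hx]
      refine (val_lt_of_firstDiff hn hk hw c x s' ?_).le
      have hs'₀ : s' ≠ [] := by
        rintro rfl
        exact hend c hs
      have hx₀ : x ≠ [] := by
        rintro rfl
        have h₁ := hs.length_le
        rw [hx] at h₁
        simp only [List.length_append, List.length_cons, List.length_nil] at h₁
        exact hs'₀ (List.length_eq_zero_iff.mp (by omega))
      linarith [hle s', hpos x hx₀]
  -- `lowEnd n z` is the value of `false :: τ`. A suffix starting with `true` exceeds it in the
  -- first letter, and one of the form `false :: s` because `s` exceeds `τ`. Empty tails have value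
  -- `w`, possibly very negative, hence the gap hypothesis.
  have lower : (∀ x, x <:+ true :: τ → val n k w x - w < t n) →
      ∀ s, s <:+ true :: τ → s ≠ [] → lowEnd n z < val n k w s := by
    intro gap
    have gap' : ∀ x s, x <:+ true :: τ → val n k w x - val n k w s < t n := by
      intro x s hx
      by_cases hs : s = []
      · rw [hs]
        exact gap x hx
      · linarith [hle x, hpos s hs]
    intro s hs hs₀
    rw [hlowEnd]
    rcases s with _ | ⟨_ | _, s⟩
    · exact absurd rfl hs₀
    · rw [val_cons]
      refine invBranch_lt hn hk (mul_val_le hn hk hw s) ?_ false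
      obtain ⟨c, s', x', rfl, rfl⟩ := hlow s hs
      refine val_lt_of_firstDiff hn hk hw c s' x' (gap' _ _ ?_)
      exact ((List.suffix_cons _ _).trans (List.suffix_append _ _)).trans (List.suffix_cons _ _)
    · exact invBranch_false_lt_true hn hk (mul_val_le hn hk hw s)
        (gap' _ _ (List.suffix_cons _ _))
  -- The two bounds would need each other; the sign of `w` decides which comes first. If `w ≤ 0`,
  -- positivity gives the upper bound, and `z - t < w` then closes the gap. If `w > 0`, the gap is
  -- automatic, and `w ≤ lowEnd n z` with the lower bound settles the prefixes.
  rcases le_or_gt w 0 with hw₀ | hw₀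
  · have up := upper fun r _ hr => hw₀.trans (hpos r hr).le
    refine ⟨lower (fun x hx => ?_) s hs hs₀, up s hs hs₀⟩
    by_cases hx₀ : x = []
    · rw [hx₀, val_nil]
      linarith
    · linarith [up x hx hx₀]
  · have low := lower fun x hx => by linarith [hle x]
    exact ⟨low s hs hs₀, upper (fun r hr hr₀ => hw₂.trans (low r hr hr₀).le) s hs hs₀⟩

end Values

/-! ### Fixed points -/

lemma exists_fixed_point {F : ℝ → ℝ} {b : ℝ} (hb : 0 < b)
    (hF : ∀ x ∈ Set.Icc 0 b, F x ∈ Set.Icc 0 b)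
    (hlip : ∀ x ∈ Set.Icc 0 b, ∀ y ∈ Set.Icc 0 b, x ≤ y → |F y - F x| ≤ (y - x) / 4) :
    ∃ p ∈ Set.Icc 0 b, F p = p ∧ ∀ x ∈ Set.Icc 0 b, (F x ≤ x ↔ p ≤ x) ∧ (x ≤ F x ↔ x ≤ p) := by
  have hlip' : LipschitzOnWith 1 F (Set.Icc 0 b) := by
    apply LipschitzOnWith.of_dist_le_mul
    intro x hx y hy
    rw [Real.dist_eq, Real.dist_eq, NNReal.coe_one, one_mul]
    rcases le_total x y with h | h
    · rw [abs_sub_comm, abs_sub_comm x y, abs_of_nonneg (sub_nonneg.mpr h)]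
      linarith [hlip x hx y hy h]
    · rw [abs_of_nonneg (sub_nonneg.mpr h)]
      linarith [hlip y hy x hx h]
  have h₀ : (0 : ℝ) ∈ Set.Icc 0 b := ⟨le_rfl, hb.le⟩
  have hb' : b ∈ Set.Icc 0 b := ⟨hb.le, le_rfl⟩
  have hcont : ContinuousOn (fun x => x - F x) (Set.Icc 0 b) :=
    continuousOn_id.sub hlip'.continuousOn
  obtain ⟨p, hp, hpF⟩ := intermediate_value_Icc hb.le hcont
    (show (0 : ℝ) ∈ Set.Icc (0 - F 0) (b - F b) from
      ⟨by linarith [(hF 0 h₀).1], by linarith [(hF b hb').2]⟩)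
  have hpF' : F p = p := by
    simp only at hpF
    linarith
  refine ⟨p, hp, hpF', fun x hx => ?_⟩
  rcases lt_trichotomy x p with h | rfl | h
  · have := abs_le.mp (hlip x hx p hp h.le)
    constructor <;> constructor <;> intro <;> linarith
  · simp [hpF']
  · have := abs_le.mp (hlip p hp x hx h.le)
    constructor <;> constructor <;> intro <;> linarith

/-! ### Lyndon words over two letters -/

section Lyndon

variable {hi lo : Bool}

lemma FirstDiff.append {s x : List Bool} (h : FirstDiff hi lo s x) (u u' : List Bool) :
    FirstDiff hi lo (s ++ u) (x ++ u') := by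
  obtain ⟨c, s', x', rfl, rfl⟩ := h
  exact ⟨c, s' ++ u, x' ++ u', by simp, by simp⟩

lemma FirstDiff.prepend {s x : List Bool} (h : FirstDiff hi lo s x) (u : List Bool) :
    FirstDiff hi lo (u ++ s) (u ++ x) := by
  obtain ⟨c, s', x', rfl, rfl⟩ := h
  exact ⟨u ++ c, s', x', by simp, by simp⟩

lemma FirstDiff.trans (hne : hi ≠ lo) {s y x : List Bool} (h : FirstDiff hi lo s y)
    (h' : FirstDiff hi lo y x) : FirstDiff hi lo s x := by
  obtain ⟨c, s', y', rfl, rfl⟩ := h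
  obtain ⟨d, y'', x', h, rfl⟩ := h'
  rw [List.append_eq_append_iff] at h
  rcases h with ⟨e, rfl, h⟩ | ⟨e, rfl, h⟩
  · rcases e with _ | ⟨a, e⟩
    · simp only [List.nil_append, List.cons.injEq] at h
      exact absurd h.1.symm hne
    · simp only [List.cons_append, List.cons.injEq] at h
      exact ⟨c, s', e ++ lo :: x', rfl, by simp [h.1]⟩
  · rcases e with _ | ⟨a, e⟩
    · simp only [List.nil_append, List.cons.injEq] at h
      exact absurd h.1 hne
    · simp only [List.cons_append, List.cons.injEq] at h
      exact ⟨d, e ++ hi :: s', x', by simp [h.1], rfl⟩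

/-- Every proper nonempty suffix is strictly larger than the word, at a position of both. -/
def Lyndon (hi lo : Bool) (x : List Bool) : Prop :=
  ∀ s, s <:+ x → s ≠ [] → s ≠ x → FirstDiff hi lo s x

/-- A suffix of `y` is at least `y`, hence beats `x ++ y`. A suffix `e ++ y` with `e` a proper
nonempty suffix of `x` wins already inside `x`. -/
lemma Lyndon.append (hne : hi ≠ lo) {x y : List Bool} (hx : Lyndon hi lo x) (hy : Lyndon hi lo y)
    (hxy : FirstDiff hi lo y (x ++ y)) : Lyndon hi lo (x ++ y) := by
  have hsuf : ∀ s, s <:+ y → s ≠ [] → FirstDiff hi lo s (x ++ y) := by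
    intro s hs hs₀
    by_cases h : s = y
    · rwa [h]
    · exact (hy s hs hs₀ h).trans hne hxy
  rintro s ⟨r, hr⟩ hs₀ hs
  rw [List.append_eq_append_iff] at hr
  rcases hr with ⟨e, rfl, rfl⟩ | ⟨e, rfl, rfl⟩
  · by_cases he : e = []
    · subst he
      exact hsuf _ (by simp) hs₀
    · refine (hx e (List.suffix_append r e) he ?_).append y y
      intro h
      apply hs
      rw [← h]
  · exact hsuf s (List.suffix_append e s) hs₀

/-- A pair of Lyndon words in the right order. -/
structure LyndonPair (hi lo : Bool) (x y : List Bool) : Prop where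
  left : Lyndon hi lo x
  right : Lyndon hi lo y
  lt : FirstDiff hi lo y (x ++ y)

lemma LyndonPair.append_left (hne : hi ≠ lo) {x y : List Bool} (h : LyndonPair hi lo x y) :
    LyndonPair hi lo (x ++ y) y :=
  ⟨h.left.append hne h.right h.lt, h.right, by simpa using h.lt.append [] y⟩

lemma LyndonPair.append_right (hne : hi ≠ lo) {x y : List Bool} (h : LyndonPair hi lo x y) :
    LyndonPair hi lo x (x ++ y) :=
  ⟨h.left, h.left.append hne h.right h.lt, h.lt.prepend x⟩

lemma lyndon_cons_replicate (hi lo : Bool) (m : ℕ) : Lyndon hi lo (lo :: List.replicate m hi) := by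
  intro s hs hs₀ hne
  rw [List.suffix_cons_iff] at hs
  rcases hs with rfl | hs
  · exact absurd rfl hne
  · rcases s with _ | ⟨a, s⟩
    · exact absurd rfl hs₀
    · have : a = hi := List.eq_of_mem_replicate (hs.subset (by simp))
      exact ⟨[], s, List.replicate m hi, by simp [this], rfl⟩

lemma lyndon_replicate_concat (hi lo : Bool) (m : ℕ) :
    Lyndon hi lo (List.replicate m lo ++ [hi]) := by
  induction m with
  | zero =>
    intro s hs hs₀ hne
    rw [List.replicate_zero, List.nil_append, List.suffix_cons_iff] at hs
    rcases hs with rfl | hs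
    · exact absurd rfl hne
    · exact absurd (List.suffix_nil.mp hs) hs₀
  | succ m ih =>
    intro s hs hs₀ hne
    have key : FirstDiff hi lo (List.replicate m lo ++ [hi]) (List.replicate (m + 1) lo ++ [hi]) :=
      ⟨List.replicate m lo, [], [hi], rfl, by
        rw [List.replicate_succ', List.append_assoc]; rfl⟩
    rw [List.replicate_succ, List.cons_append, List.suffix_cons_iff] at hs
    rcases hs with rfl | hs
    · exact absurd rfl hne
    · by_cases h : s = List.replicate m lo ++ [hi]
      · rw [h]
        exact key
      · obtain ⟨c, s', x', rfl, hx⟩ := ih s hs hs₀ h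
        have hc : c.length < m := by
          by_contra hlt
          have hlen := congrArg List.length hx
          simp only [List.length_append, List.length_replicate, List.length_cons,
            List.length_nil] at hlen
          have hle := hs.length_le
          simp only [List.length_append, List.length_replicate, List.length_cons,
            List.length_nil] at hle
          apply h
          exact hs.eq_of_length (by simp; omega)
        refine ⟨c, s', List.replicate (m - c.length) lo ++ [hi], rfl, ?_⟩
        have e : c = List.replicate c.length lo := by
          have h₁ : c <+: List.replicate m lo ++ [hi] := ⟨_, hx.symm⟩
          have h₂ : c <+: List.replicate m lo :=
            List.prefix_of_prefix_length_le h₁ (List.prefix_append _ _) (by simp; omega)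
          exact List.eq_replicate_iff.mpr ⟨rfl, fun b hb => List.eq_of_mem_replicate (h₂.subset hb)⟩
        have e₂ : m + 1 = c.length + ((m - c.length) + 1) := by omega
        rw [e₂, List.replicate_add, ← e, List.replicate_succ, List.append_assoc, List.cons_append]

lemma lyndonPair_cons_replicate (hi lo : Bool) (m : ℕ) :
    LyndonPair hi lo (lo :: List.replicate m hi) (lo :: List.replicate (m + 1) hi) :=
  ⟨lyndon_cons_replicate hi lo m, lyndon_cons_replicate hi lo (m + 1),
    lo :: List.replicate m hi, [], List.replicate (m + 1) hi, by
      rw [List.replicate_succ', List.cons_append], rfl⟩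

lemma lyndonPair_replicate_concat (hi lo : Bool) (m : ℕ) :
    LyndonPair hi lo (List.replicate (m + 1) lo ++ [hi]) (List.replicate m lo ++ [hi]) :=
  ⟨lyndon_replicate_concat hi lo (m + 1), lyndon_replicate_concat hi lo m,
    List.replicate m lo, [], hi :: (List.replicate m lo ++ [hi]), rfl, by
      rw [List.replicate_succ', List.append_assoc, List.append_assoc]; rfl⟩

end Lyndon

/-! ### Central words -/

/-- The central words `p`, `q` of a pair of Christoffel words. -/
structure CentralPair (p q : List Bool) : Prop where
  lower : LyndonPair true false (false :: (p ++ [true])) (false :: (q ++ [true]))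
  upper : LyndonPair false true (true :: (q ++ [false])) (true :: (p ++ [false]))
  comm : p ++ true :: false :: q = q ++ false :: true :: p

/-- Concatenating the lower words gives `(0p1)(0q1) = 0(p10q)1`, and the upper ones `(1q0)(1p0) =
1(q01p)0`. The relation `comm` says that these have the same central word, so the lower and upper
pairs grow in step. -/
lemma CentralPair.right {p q : List Bool} (h : CentralPair p q) :
    CentralPair p (p ++ true :: false :: q) where
  lower := by simpa using h.lower.append_right (by simp)
  upper := by
    rw [h.comm]
    simpa using h.upper.append_left (by simp)
  comm := by
    nth_rewrite 1 [h.comm]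
    simp

lemma CentralPair.left {p q : List Bool} (h : CentralPair p q) :
    CentralPair (p ++ true :: false :: q) q where
  lower := by simpa using h.lower.append_left (by simp)
  upper := by
    rw [h.comm]
    simpa using h.upper.append_right (by simp)
  comm := by
    nth_rewrite 1 [h.comm]
    simp

lemma CentralPair.pow {p q : List Bool} (h : CentralPair p q) (m : ℕ) :
    ∃ q', CentralPair p q' ∧
      wpow (false :: (p ++ [true])) m ++ false :: (q ++ [true]) = false :: (q' ++ [true]) := by
  induction m with
  | zero => exact ⟨q, h, by simp [wpow_zero]⟩
  | succ m ih =>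
    obtain ⟨q', hq', e⟩ := ih
    refine ⟨p ++ true :: false :: q', hq'.right, ?_⟩
    rw [wpow_succ, List.append_assoc, e]
    simp

lemma centralPair_replicate_true (m : ℕ) :
    CentralPair (List.replicate m true) (List.replicate (m + 1) true) where
  lower := by
    rw [← List.replicate_succ', ← List.replicate_succ']
    exact lyndonPair_cons_replicate true false (m + 1)
  upper := by
    rw [← List.cons_append, ← List.cons_append, ← List.replicate_succ, ← List.replicate_succ]
    exact lyndonPair_replicate_concat false true (m + 1)
  comm := by
    have h : ∀ l, List.replicate m true ++ true :: l = true :: (List.replicate m true ++ l) := fun l => by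
      rw [← List.singleton_append, ← List.append_assoc, ← List.replicate_succ',
        List.replicate_succ, List.cons_append]
    simp [List.replicate_succ, h]

lemma centralPair_replicate_false (m : ℕ) :
    CentralPair (List.replicate (m + 1) false) (List.replicate m false) where
  lower := by
    rw [← List.cons_append, ← List.cons_append, ← List.replicate_succ, ← List.replicate_succ]
    exact lyndonPair_replicate_concat true false (m + 1)
  upper := by
    rw [← List.replicate_succ', ← List.replicate_succ']
    exact lyndonPair_cons_replicate false true (m + 1)
  comm := by
    have h : ∀ l, List.replicate m false ++ false :: l = false :: (List.replicate m false ++ l) := fun l => by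
      rw [← List.singleton_append, ← List.append_assoc, ← List.replicate_succ',
        List.replicate_succ, List.cons_append]
    simp [List.replicate_succ, h]

/-- For suffixes starting with `0`, drop the common first letter in the Lyndon property of `0p1`.
For the other condition, write a proper nonempty suffix of `1p1` as `s₁1`; then `s₁0` is a suffix of
`1p0`, which is Lyndon for the reversed order. -/
lemma CentralPair.admissible {p q : List Bool} (h : CentralPair p q) :
    Admissible (true :: (p ++ [true])) := by
  refine ⟨⟨_, rfl, fun s hs => ?_⟩, fun s hs => ?_⟩
  · rw [List.suffix_cons_iff] at hs
    rcases hs with hs | hs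
    · simp at hs
    · obtain ⟨c, s', x', h₁, h₂⟩ := h.lower.left (false :: s) (hs.trans (List.suffix_cons _ _))
        (by simp) (by rintro e; have := hs.length_le; rw [e] at this; simp at this)
      rcases c with _ | ⟨a, c⟩
      · simp at h₁
      · simp only [List.cons_append, List.cons.injEq] at h₁ h₂
        exact ⟨c, s', x', h₁.2, h₂.2⟩
  · rw [List.suffix_cons_iff] at hs
    rcases hs with rfl | hs
    · exact Or.inl List.prefix_rfl
    rcases List.eq_nil_or_concat s with rfl | ⟨s₁, b, rfl⟩
    · exact Or.inl List.nil_prefix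
    obtain ⟨r, hr⟩ := hs
    rw [List.concat_eq_append, ← List.append_assoc] at hr
    obtain ⟨rfl, hb⟩ := List.append_inj' hr rfl
    obtain rfl : b = true := by simpa using hb
    obtain ⟨c, s', x', h₁, h₂⟩ := h.upper.right (s₁ ++ [false]) ⟨true :: r, by simp⟩ (by simp)
      (by intro e; have := congrArg List.length e; simp at this; omega)
    rcases List.eq_nil_or_concat x' with rfl | ⟨x₁, d, rfl⟩
    · have := congrArg List.reverse h₂
      simp at this
    have h₃ : true :: (r ++ s₁) ++ [false] = c ++ true :: x₁ ++ [d] := by simpa using h₂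
    obtain ⟨h₄, -⟩ := List.append_inj' h₃ rfl
    have h₅ : true :: (r ++ s₁ ++ [true]) = c ++ true :: (x₁ ++ [true]) := by
      rw [← List.cons_append, h₄]
      simp
    rw [List.concat_eq_append, h₅]
    -- If `s₁0` first differs from `1p0` at its last letter, turning that letter into `1` leaves a
    -- prefix of `1p1`; an earlier difference survives the change.
    rcases List.eq_nil_or_concat s' with rfl | ⟨s₂, d', rfl⟩
    · obtain ⟨rfl, -⟩ := List.append_inj' h₁ rfl
      exact Or.inl ⟨x₁ ++ [true], by simp⟩
    · have h₆ : s₁ ++ [false] = c ++ false :: s₂ ++ [d'] := by simpa using h₁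
      obtain ⟨rfl, -⟩ := List.append_inj' h₆ rfl
      exact Or.inr ⟨c, x₁ ++ [true], s₂ ++ [true], rfl, by simp⟩

lemma admissible_replicate (c : ℕ) : Admissible (List.replicate (c + 1) true) := by
  refine ⟨⟨List.replicate c true, rfl, fun s hs => ?_⟩, fun s hs => Or.inl ?_⟩
  · have := List.eq_of_mem_replicate (hs.subset (List.mem_cons_self ..))
    simp at this
  · have e : s = List.replicate s.length true :=
      List.eq_replicate_iff.mpr ⟨rfl, fun b hb => List.eq_of_mem_replicate (hs.subset hb)⟩
    have hle := hs.length_le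
    rw [List.length_replicate] at hle
    refine ⟨List.replicate (c + 1 - s.length) true, ?_⟩
    nth_rewrite 1 [e]
    rw [← List.replicate_add]
    congr 1
    omega

/-! ### The words of the tree -/

lemma letters_append_of_even {u : List ℕ} (h : Even u.length) (b : Bool) (v : List ℕ) :
    letters b (u ++ v) = letters b u ++ letters b v := by
  induction u using List.twoStepInduction with
  | nil => rfl
  | singleton c => simp at h
  | cons_cons c d u ih _ =>
    have h' : Even u.length := by
      simpa [Nat.even_add_one] using h
    simp [letters, ih h']

lemma letters_append_of_odd {u : List ℕ} (h : Odd u.length) (b : Bool) (v : List ℕ) :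
    letters b (u ++ v) = letters b u ++ letters (!b) v := by
  rcases u with _ | ⟨c, u⟩
  · simp at h
  · have h' : Even u.length := by
      simpa [Nat.odd_add_one] using h
    simp [letters, letters_append_of_even h']

lemma even_length_wpow {u : List ℕ} (h : Even u.length) (q : ℕ) : Even (wpow u q).length := by
  induction q with
  | zero => simp [wpow_zero]
  | succ q ih => rw [wpow_succ, List.length_append]; exact h.add ih

lemma letters_wpow {u : List ℕ} (h : Even u.length) (b : Bool) (q : ℕ) :
    letters b (wpow u q) = wpow (letters b u) q := by
  induction q with
  | zero => rfl
  | succ q ih => rw [wpow_succ, wpow_succ, letters_append_of_even h, ih]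

/-- On binary words, passing from `v` to `v'` flips the first letter: `1p1` becomes `0p1`. The even
length makes powers of `v'` restart with the same letter. -/
lemma prime_spec {v : List ℕ} {c : ℕ} {w : List ℕ} (hv : v = c :: w) (hc : 1 ≤ c) (hv₁ : v ≠ [1])
    (hodd : Odd v.length) :
    Even (prime v).length ∧ letters false (prime v) = false :: (letters true v).tail := by
  subst hv
  obtain ⟨c, rfl⟩ : ∃ m, c = m + 1 := ⟨c - 1, by omega⟩
  rcases w with _ | ⟨d, w⟩
  · have h : c ≠ 0 := by rintro rfl; simp at hv₁
    simp [prime, h, letters, List.replicate_succ]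
  · have h' : Odd w.length := by
      simp only [List.length_cons] at hodd
      rw [Nat.odd_add_one, Nat.not_odd_iff_even, Nat.even_add_one, Nat.not_even_iff_odd] at hodd
      exact hodd
    by_cases h : c = 0
    · subst h
      simp [prime, letters, List.replicate_succ, h']
    · simp [prime, h, letters, List.replicate_succ, Nat.even_add_one, h']

/-- What is known of a word `v` of the tree with its suffix `x = v''`. -/
structure NodeSpec (v x : List ℕ) : Prop where
  odd : Odd v.length
  even : Even x.length
  head : ∃ c w, v = c :: w ∧ 1 ≤ c
  ne_one : v ≠ [1]
  central : ∃ p q, CentralPair p q ∧ letters true v = true :: (p ++ [true]) ∧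
    letters false x = false :: (q ++ [true])

/-- The new word is `1p1 (0p1)^m 0q1 = 1p1 0q'1`, whose central word is `p10q'`; the new suffix
keeps `q'`. -/
lemma NodeSpec.theta {v x : List ℕ} (h : NodeSpec v x) (m : ℕ) :
    NodeSpec (v ++ (wpow (prime v) m ++ x)) (wpow (prime v) m ++ x) := by
  obtain ⟨c, w, hv, hc⟩ := h.head
  obtain ⟨p, q, hpq, hp, hq⟩ := h.central
  obtain ⟨he, hl⟩ := prime_spec hv hc h.ne_one h.odd
  have hev : Even (wpow (prime v) m ++ x).length := by
    rw [List.length_append]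
    exact (even_length_wpow he m).add h.even
  obtain ⟨q', hq', e⟩ := hpq.pow m
  rw [hp, List.tail_cons] at hl
  have hx : letters false (wpow (prime v) m ++ x) = false :: (q' ++ [true]) := by
    rw [letters_append_of_even (even_length_wpow he m), letters_wpow he, hl, hq, e]
  refine ⟨?_, hev, ⟨c, w ++ (wpow (prime v) m ++ x), by rw [hv]; rfl, hc⟩, ?_,
    p ++ true :: false :: q', q', hq'.left, ?_, hx⟩
  · rw [List.length_append]
    exact h.odd.add_even hev
  · intro e₁
    have h₁ := congrArg List.length e₁
    have h₂ : (wpow (prime v) m ++ x) ≠ [] := by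
      intro h₀
      rw [h₀] at hx
      simp [letters] at hx
    have h₃ := List.length_pos_iff.mpr h₂
    rw [List.length_append, hv] at h₁
    rw [hv] at h₃
    simp only [List.length_cons, List.length_nil] at h₁
    omega
  · rw [letters_append_of_odd h.odd, hp, Bool.not_true, hx]
    simp

lemma IsTheta.spec {q : ℤ} {u v : List ℕ} (h : IsTheta q u v) :
    (q = -1 ∧ ∃ c, v = [c + 1]) ∨ (0 ≤ q ∧ ∃ x, v = u ++ x ∧ NodeSpec v x) := by
  induction h with
  | neg_one c hc => exact Or.inl ⟨rfl, c, rfl⟩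
  | of_one q hq =>
    obtain ⟨m, rfl⟩ : ∃ m, q = m + 1 := ⟨q - 1, by omega⟩
    refine Or.inr ⟨by positivity, [m + 1, 1], rfl, ⟨1, rfl⟩, ⟨1, rfl⟩, ⟨1, _, rfl, le_rfl⟩,
      by simp, _, _, centralPair_replicate_false m, ?_, ?_⟩
    · simp [letters]
    · simp [letters, List.replicate_succ]
  | of_single c q hc =>
    obtain ⟨m, rfl⟩ : ∃ m, c = m + 2 := ⟨c - 2, by omega⟩
    -- A single letter `c ≥ 2` behaves like a node with suffix `1 c`, so `Θ_q(c)` is a case of the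
    -- general step.
    have h₀ : NodeSpec [m + 2] [1, m + 2] := by
      refine ⟨by simp, by simp, ⟨m + 2, [], rfl, by omega⟩, by simp, _, _,
        centralPair_replicate_true m, ?_, ?_⟩
      · rw [letters, letters, List.append_nil, List.replicate_succ, List.replicate_succ']
      · simp [letters, List.replicate_succ']
    have h₁ := h₀.theta q
    refine Or.inr ⟨by positivity, wpow [1, m + 2 - 1] q ++ [1, m + 2], ?_, ?_⟩
    · simp
    · have e : prime [m + 2] = [1, m + 2 - 1] := by simp [prime]
      rw [e] at h₁
      simpa using h₁
  | step p q u x _ ih =>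
    rcases ih with ⟨h, -⟩ | ⟨-, x', hx', h⟩
    · omega
    · obtain rfl := List.append_cancel_left hx'
      refine Or.inr ⟨by positivity, wpow (prime (u ++ x)) q ++ x, by simp, ?_⟩
      simpa using h.theta q

theorem IsTreeWord.admissible {v : List ℕ} (hv : IsTreeWord v) : Admissible (letters true v) := by
  cases hv with
  | root => simpa [letters] using admissible_replicate 0
  | child q u v hu h =>
    rcases h.spec with ⟨-, c, rfl⟩ | ⟨-, x, -, hx⟩
    · simpa [letters] using admissible_replicate c
    · obtain ⟨p, q, hpq, hp, -⟩ := hx.central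
      rw [hp]
      exact hpq.admissible

/-! ### The orbits of the two endpoints -/

/-- The representative of `x` in the interval `𝕀_α` modulo translation by `t`. -/
noncomputable def reduce (n : ℕ) (α : ℝ) (x : OnePoint ℝ) : OnePoint ℝ := A n ^ aExp n α x • x

lemma T_coe (n : ℕ) (α x : ℝ) :
    T n α (x : OnePoint ℝ) = reduce n α (C ^ cExp n α x • (x : OnePoint ℝ)) := by
  rw [T, if_neg (OnePoint.coe_ne_infty x), reduce]

lemma reduce_coe (n : ℕ) (α x : ℝ) :
    reduce n α (x : OnePoint ℝ) = ((x + aExp n α x * t n : ℝ) : OnePoint ℝ) := by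
  rw [reduce, A_zpow_smul]

lemma aExp_sub {n : ℕ} (hn : 3 ≤ n) (α x : ℝ) :
    aExp n α ((x - t n : ℝ) : OnePoint ℝ) = aExp n α x + 1 := by
  have ht : t n ≠ 0 := by linarith [two_le_t hn]
  have e : (x - t n) / t n + 1 - α = x / t n + 1 - α - 1 := by
    rw [sub_div, div_self ht]
    ring
  rw [aExp, aExp, OnePoint.elim_some, OnePoint.elim_some, e, Int.floor_sub_one]
  ring

lemma reduce_A_inv_smul {n : ℕ} (hn : 3 ≤ n) (α : ℝ) (x : OnePoint ℝ) :
    reduce n α ((A n)⁻¹ • x) = reduce n α x := by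
  induction x using OnePoint.rec with
  | infty => rw [A_inv_smul_infty]
  | coe x =>
    rw [A_inv_smul, reduce_coe, reduce_coe, aExp_sub hn]
    congr 1
    push_cast
    ring

lemma reduce_coe_mem {n : ℕ} (hn : 3 ≤ n) (α x : ℝ) :
    reduce n α (x : OnePoint ℝ) ∈ interval n α := by
  have ht : 0 < t n := by linarith [two_le_t hn]
  have h₁ := Int.floor_le (x / t n + 1 - α)
  have h₂ := Int.lt_floor_add_one (x / t n + 1 - α)
  have e : x / t n + 1 - α = (x + t n - α * t n) / t n := by field_simp
  rw [reduce_coe, coe_mem_interval, ell0, r0, aExp, OnePoint.elim_some]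
  push_cast
  nth_rewrite 2 [e] at h₁
  nth_rewrite 1 [e] at h₂
  rw [le_div_iff₀ ht] at h₁
  rw [div_lt_iff₀ ht] at h₂
  constructor <;> linarith

lemma C_pow_smul_real {x : ℝ} (h₀ : x ≠ 0) (h₁ : x ≠ 1) (l : ℕ) :
    ∃ y : ℝ, C ^ l • (x : OnePoint ℝ) = (y : OnePoint ℝ) := by
  have e : C ^ l = C ^ (l % 3) := pow_eq_pow_mod l C_pow_three
  rw [e]
  have hl : l % 3 < 3 := Nat.mod_lt l (by norm_num)
  interval_cases l % 3
  · exact ⟨x, by simp⟩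
  · exact ⟨_, by rw [pow_one, C_smul h₀]⟩
  · exact ⟨_, C_sq_smul h₁⟩

lemma T_real {n : ℕ} {α x : ℝ} (h₀ : x ≠ 0) (h₁ : x ≠ 1) :
    ∃ y : ℝ, T n α (x : OnePoint ℝ) = (y : OnePoint ℝ) := by
  obtain ⟨y, hy⟩ := C_pow_smul_real h₀ h₁ (cExp n α x)
  exact ⟨_, by rw [T_coe, hy, reduce_coe]⟩

section Orbits

variable {n k : ℕ} {α z w : ℝ}

lemma lowEnd_le (hn : 3 ≤ n) (hz₀ : 0 ≤ z) : lowEnd n z ≤ z := by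
  have ht := two_le_t hn
  have : 0 < t n * z + 1 := by positivity
  rw [lowEnd, div_le_iff₀ this]
  nlinarith [mul_nonneg (by linarith : 0 ≤ t n) (mul_nonneg hz₀ hz₀)]

lemma one_div_lowEnd (hz₀ : z ≠ 0) : 1 / lowEnd n z = t n + 1 / z := by
  rw [lowEnd, one_div_div]
  field_simp

lemma lowEnd_pos (hn : 3 ≤ n) (hz₀ : 0 < z) : 0 < lowEnd n z := by
  have ht := two_le_t hn
  rw [lowEnd]
  positivity

lemma one_sub_one_div_neg_invBranch (c : Bool) (u : ℝ) :
    1 - 1 / (-invBranch n k c u) = (if c then (k : ℝ) else k + 1) * t n - u := by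
  rw [one_div_neg_eq_neg_one_div, invBranch, one_div_one_div]
  ring

lemma Follows.left (hn : 3 ≤ n) (hk : 2 ≤ k) (hα : ell0 n α = -z) (hz₀ : 0 < z)
    (hz : t n * z ≤ 1) (hw : t n * w ≤ 1) (hw₁ : z - t n < w) (hw₂ : w ≤ z) (l : List Bool)
    (hl : ∀ s, s <:+ l → s ≠ [] → val n k w s ≤ z) :
    Follows n α ((-val n k w l : ℝ) : OnePoint ℝ)
      (l.map fun c => (if c then -(k : ℤ) else -(k : ℤ) - 1, 1)) ((-w : ℝ) : OnePoint ℝ) := by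
  have ht := two_le_t hn
  induction l with
  | nil => exact Follows.nil n α _
  | cons c l ih =>
    have ih' := ih fun s hs => hl s (hs.trans (List.suffix_cons c l))
    rw [List.map_cons]
    refine Follows.cons (Follows.step_one hn ?_ ?_ ?_ ?_ ?_) ih'
    · rw [val_cons]
      exact neg_ne_zero.mpr (invBranch_pos hn hk (mul_val_le hn hk hw l) c).ne'
    · cases c <;> simp <;> omega
    · rw [val_cons, one_sub_one_div_neg_invBranch]
      cases c <;> simp <;> ring
    · rw [hα, neg_le_neg_iff]
      by_cases h : l = []
      · rw [h]
        exact hw₂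
      · exact hl l (List.suffix_cons c l) h
    · rw [r0_eq, hα]
      by_cases h : l = []
      · rw [h, val_nil]
        linarith
      · have := val_pos hn hk hw h
        nlinarith

/-- The digits of the right orbit that correspond to a letter. -/
def letterBlock (n k : ℕ) (c : Bool) : List (ℤ × ℕ) := if c then blockE n k else blockF n k

lemma Follows.right (hn : 3 ≤ n) (hk : 2 ≤ k) (hα : ell0 n α = -z) (hz₀ : 0 < z)
    (hz : t n * z ≤ 1) (hw : t n * w ≤ 1) (hw₂ : w ≤ z) (l : List Bool)
    (hl : ∀ s, s <:+ l → s ≠ [] → lowEnd n z < val n k w s ∧ val n k w s ≤ z) :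
    Follows n α (mirror n (val n k w l) : OnePoint ℝ) (l.flatMap (letterBlock n k))
      (mirror n w : OnePoint ℝ) := by
  induction l with
  | nil => exact Follows.nil n α _
  | cons c l ih =>
    have ih' := ih fun s hs => hl s (hs.trans (List.suffix_cons c l))
    have hle : val n k w l ≤ z := by
      by_cases h : l = []
      · rw [h]
        exact hw₂
      · exact (hl l (List.suffix_cons c l) h).2
    have hpos := invBranch_pos hn hk (mul_val_le hn hk hw l) c
    have hlow : 1 / invBranch n k c (val n k w l) < t n + 1 / z := by
      rw [← one_div_lowEnd hz₀.ne']
      exact one_div_lt_one_div_of_lt (lowEnd_pos hn hz₀)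
        (hl (c :: l) List.suffix_rfl (by simp)).1
    have hone := one_sub_one_div_neg_invBranch (n := n) (k := k) c (val n k w l)
    rw [one_div_neg_eq_neg_one_div, sub_neg_eq_add] at hone
    rw [List.flatMap_cons, val_cons]
    refine Follows.append ?_ ih'
    cases c
    · refine Follows.block hn hα hz₀ hz (k - 1) hpos (mul_invBranch_le hn hk
        (mul_val_le hn hk hw l) _) hle ?_ hlow
      rw [hone, Nat.cast_sub (by omega)]
      simp only [Bool.false_eq_true, if_false]
      push_cast
      ring
    · refine Follows.block hn hα hz₀ hz (k - 2) hpos (mul_invBranch_le hn hk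
        (mul_val_le hn hk hw l) _) hle ?_ hlow
      rw [hone, Nat.cast_sub hk]
      simp only [if_true]
      push_cast
      ring

/-- The start is `r₀ = t - z = topPoint n (1 + 1/z)`, so the run applies with `Q = 1 + 1/z - t`;
`hz₁` is the condition `t - z ≤ Q`. -/
lemma Follows.right_start (hn : 3 ≤ n) (hα : ell0 n α = -z) (hz₀ : 0 < z) (hz : t n * z ≤ 1)
    (hz₁ : 2 * t n ≤ 1 + 1 / z + z) :
    Follows n α (r0 n α : OnePoint ℝ) (wpow [(1, 2)] (n - 2)) (mirror n z : OnePoint ℝ) := by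
  have h := Follows.one_two_pow hn hα hz₀ hz (Q := 1 + 1 / z - t n) (by linarith) (by linarith)
  have e : topPoint n (1 + 1 / z - t n + t n) = r0 n α := by
    rw [r0_eq, hα, topPoint, sub_add_cancel, add_sub_cancel_left, one_div_one_div]
    ring
  rwa [e, ← mirror_eq hz₀.ne' (sub_one_mul_lt_one hn hz)] at h

/-! ### Synchronization -/

/-- The bound `w ≤ lowEnd n z` amounts to `mirror n w ≥ 1/(1 + z)`, that is `C · mirror n w ≥ -z =
ℓ₀`. -/
lemma C_smul_mirror_mem (hn : 3 ≤ n) (hα : ell0 n α = -z) (hz₀ : 0 < z) (hz : t n * z ≤ 1)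
    (hw₂ : w ≤ lowEnd n z) : C • (mirror n w : OnePoint ℝ) ∈ interval n α := by
  have ht := two_le_t hn
  have hw : t n * w ≤ 1 := (mul_le_mul_of_nonneg_left hw₂ (by linarith)).trans
    (mul_lowEnd_le hn hz₀.le)
  have hd : 0 < 1 - (t n - 1) * w := by linarith [sub_one_mul_lt_one hn hw]
  have hy : 1 / (1 + z) ≤ mirror n w := by
    rw [lowEnd, le_div_iff₀ (by positivity)] at hw₂
    have : w / (1 - (t n - 1) * w) ≤ z / (1 + z) := by
      rw [div_le_div_iff₀ hd (by linarith)]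
      linarith
    have e : 1 / (1 + z) = 1 - z / (1 + z) := by
      field_simp
      ring
    rw [e, mirror]
    linarith
  have hy₀ : 0 < mirror n w := lt_of_lt_of_le (by positivity) hy
  have hr := one_le_r0 hn hα hz
  have h₁ : 1 / mirror n w ≤ 1 + z := by
    rw [div_le_comm₀ hy₀ (by linarith)]
    exact hy
  have h₂ : 0 < 1 / mirror n w := by positivity
  rw [C_smul hy₀.ne', coe_mem_interval, hα]
  constructor <;> linarith

lemma C_smul_neg_cases (w : ℝ) :
    w = 0 ∧ C • ((-w : ℝ) : OnePoint ℝ) = ∞ ∨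
      w ≠ 0 ∧ C • ((-w : ℝ) : OnePoint ℝ) = ((1 + 1 / w : ℝ) : OnePoint ℝ) := by
  by_cases h : w = 0
  · left
    rw [h, neg_zero, C_smul_zero]
    exact ⟨rfl, rfl⟩
  · right
    rw [C_smul (neg_ne_zero.mpr h), one_div_neg_eq_neg_one_div, sub_neg_eq_add]
    exact ⟨h, rfl⟩

lemma one_div_ge_of_le_lowEnd (hz₀ : 0 < z) (hw₀ : 0 < w) (hw₂ : w ≤ lowEnd n z) :
    t n + 1 / z ≤ 1 / w := by
  rw [← one_div_lowEnd hz₀.ne']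
  exact one_div_le_one_div_of_le hw₀ hw₂

lemma A_inv_C_smul_notMem (hn : 3 ≤ n) (hα : ell0 n α = -z) (hz₀ : 0 < z) (hz : t n * z ≤ 1)
    (hw₂ : w ≤ lowEnd n z) :
    (A n)⁻¹ • C • ((-w : ℝ) : OnePoint ℝ) ∉ interval n α := by
  have ht := two_le_t hn
  have ht' : t n ≤ 1 / z := by rwa [le_div_iff₀ hz₀]
  rcases C_smul_neg_cases w with ⟨-, e⟩ | ⟨h, e⟩
  · rw [e, A_inv_smul_infty]
    exact infty_notMem_interval
  · rw [e, A_inv_smul, coe_mem_interval, r0_eq, hα]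
    rintro ⟨h₁, h₂⟩
    rcases lt_or_gt_of_ne h with h | h
    · have : 1 / w < 0 := one_div_neg.mpr h
      nlinarith
    · have := one_div_ge_of_le_lowEnd hz₀ h hw₂
      linarith

lemma C_sq_smul_notMem (hn : 3 ≤ n) (hα : ell0 n α = -z) (hz₀ : 0 < z) (hz : t n * z ≤ 1)
    (hw₁ : z - t n < w) (hw₂ : w ≤ lowEnd n z)
    (hC : C • ((-w : ℝ) : OnePoint ℝ) ∈ interval n α) :
    C ^ 2 • ((-w : ℝ) : OnePoint ℝ) ∉ interval n α := by
  have ht := two_le_t hn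
  have ht' : t n ≤ 1 / z := by rwa [le_div_iff₀ hz₀]
  rcases C_smul_neg_cases w with ⟨-, e⟩ | ⟨h, e⟩
  · rw [e] at hC
    exact absurd hC infty_notMem_interval
  rw [e, coe_mem_interval, r0_eq, hα] at hC
  rcases lt_or_gt_of_ne h with h | h
  · by_cases hw : -w = 1
    · rw [hw, C_sq_smul_one]
      exact infty_notMem_interval
    · rw [C_sq_smul hw, coe_mem_interval, r0_eq, hα, sub_neg_eq_add]
      rintro ⟨h₁, h₂⟩
      -- For `-w < 1` the image `1/(1 + w)` is at least `1/z ≥ t`, beyond `r₀`. For `-w > 1` it is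
      -- negative and below `ℓ₀`, because `-w < r₀`.
      rcases lt_or_gt_of_ne hw with hw | hw
      · have hpos : 0 < 1 + w := by linarith
        have h₃ : 1 / (-w) ≤ 1 + z := by
          rw [one_div_neg_eq_neg_one_div]
          linarith [hC.1]
        rw [div_le_iff₀ (by linarith)] at h₃
        have h₄ : 1 / z ≤ 1 / (1 + w) := by
          apply one_div_le_one_div_of_le hpos
          nlinarith
        linarith
      · have hneg : 0 < -(1 + w) := by linarith
        have h₃ : 1 / (-(1 + w)) ≤ z := by
          rw [one_div_neg_eq_neg_one_div]
          linarith
        rw [div_le_iff₀ hneg] at h₃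
        nlinarith
  · have := one_div_ge_of_le_lowEnd hz₀ h hw₂
    linarith [hC.2]

lemma T_mirror (hn : 3 ≤ n) (hα : ell0 n α = -z) (hz₀ : 0 < z) (hz : t n * z ≤ 1)
    (hw₂ : w ≤ lowEnd n z) :
    cExp n α (mirror n w : OnePoint ℝ) = 2 ∧
      C ^ 2 • (mirror n w : OnePoint ℝ) = (A n)⁻¹ • C • ((-w : ℝ) : OnePoint ℝ) := by
  have ht := two_le_t hn
  have hw : t n * w ≤ 1 := (mul_le_mul_of_nonneg_left hw₂ (by linarith)).trans
    (mul_lowEnd_le hn hz₀.le)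
  have e : C ^ 2 • (mirror n w : OnePoint ℝ) = (A n)⁻¹ • C • ((-w : ℝ) : OnePoint ℝ) := by
    rw [← M_inv_smul n (sub_one_mul_lt_one hn hw), smul_smul, smul_smul, M_inv, ← C_inv]
    congr 1
    group
  refine ⟨cExp_eq one_le_two ?_ ?_, e⟩
  · rw [e]
    exact A_inv_C_smul_notMem hn hα hz₀ hz hw₂
  · intro j hj hj'
    obtain rfl : j = 1 := by omega
    rw [pow_one]
    exact C_smul_mirror_mem hn hα hz₀ hz hw₂

theorem synchronization (hn : 3 ≤ n) (hα : ell0 n α = -z) (hz₀ : 0 < z) (hz : t n * z ≤ 1)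
    (hw₁ : z - t n < w) (hw₂ : w ≤ lowEnd n z) :
    (digit n α (mirror n w : OnePoint ℝ) = some (1, 2) →
      T n α ((-w : ℝ) : OnePoint ℝ) = T n α (T n α (mirror n w : OnePoint ℝ))) ∧
    (digit n α (mirror n w : OnePoint ℝ) ≠ some (1, 2) →
      T n α ((-w : ℝ) : OnePoint ℝ) = T n α (mirror n w : OnePoint ℝ)) := by
  obtain ⟨hc, hsq⟩ := T_mirror hn hα hz₀ hz hw₂
  have hT : T n α (mirror n w : OnePoint ℝ) = reduce n α (C • ((-w : ℝ) : OnePoint ℝ)) := by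
    rw [T_coe, hc, hsq, reduce_A_inv_smul hn]
  -- If `C · (-w)` is in `𝕀_α`, it is the next right point itself, reached by the digit `(1,2)`, and
  -- one more `C` gives what `C²` does on the left. Otherwise both sides reduce the same point `C ·
  -- (-w)`, and the digit cannot be `(1,2)`.
  by_cases hC : C • ((-w : ℝ) : OnePoint ℝ) ∈ interval n α
  · obtain ⟨y, hy, hy'⟩ : ∃ y : ℝ, y ∈ Set.Ico (ell0 n α) (r0 n α) ∧
        (y : OnePoint ℝ) = C • ((-w : ℝ) : OnePoint ℝ) := id hC
    have ha : aExp n α (y : OnePoint ℝ) = 0 := aExp_eq hn (by simpa using hy.1)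
      (by simpa using hy.2)
    have hT' : T n α (mirror n w : OnePoint ℝ) = C • ((-w : ℝ) : OnePoint ℝ) := by
      rw [hT, ← hy', reduce_coe, ha]
      simp
    have h₂ := C_sq_smul_notMem hn hα hz₀ hz hw₁ hw₂ hC
    constructor
    · intro _
      have hc₁ : cExp n α ((-w : ℝ) : OnePoint ℝ) = 2 := by
        refine cExp_eq one_le_two h₂ fun j hj hj' => ?_
        obtain rfl : j = 1 := by omega
        rwa [pow_one]
      have hc₂ : cExp n α (C • ((-w : ℝ) : OnePoint ℝ)) = 1 := by
        refine cExp_eq le_rfl ?_ fun j hj hj' => by omega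
        rwa [pow_one, smul_smul, ← pow_two]
      rw [hT', T_coe, hc₁, ← hy', T_coe, hy', hc₂, pow_one, smul_smul, ← pow_two]
    · intro hd
      refine absurd ?_ hd
      rw [digit, hT', if_neg, hc, hsq, ← hy', A_inv_smul, aExp_sub hn, ha]
      · rfl
      · rw [← hy']
        exact OnePoint.coe_ne_infty y
  · have hc₁ : cExp n α ((-w : ℝ) : OnePoint ℝ) = 1 :=
      cExp_eq le_rfl (by rwa [pow_one]) fun j hj hj' => by omega
    constructor
    · intro hd
      exfalso
      rw [digit] at hd
      split_ifs at hd with h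
      rw [hc, hsq] at hd
      rcases C_smul_neg_cases w with ⟨-, e⟩ | ⟨-, e⟩
      · rw [hT, e, reduce, A_zpow_smul_infty] at h
        exact h rfl
      · rw [e, A_inv_smul, aExp_sub hn] at hd
        have ha : aExp n α ((1 + 1 / w : ℝ) : OnePoint ℝ) = 0 := by
          simpa using hd
        apply hC
        have := reduce_coe_mem hn α (1 + 1 / w)
        rw [reduce_coe, ha] at this
        rw [e]
        simpa using this
    · intro _
      rw [T_coe, hc₁, pow_one, hT]

end Orbits

/-! ### The synchronization interval -/

section Interval

variable {n k : ℕ} {v : List ℕ}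

lemma L_mul_A (n k : ℕ) (v : List ℕ) :
    L n k v * A n = wordProd (letterMat n k) (letters true v) := by
  rw [L, inv_mul_cancel_right, ← expandMul_eq_wordProd]
  rfl

lemma L_smul_r0 (n k : ℕ) (v : List ℕ) (α : ℝ) :
    L n k v • (r0 n α : OnePoint ℝ) =
      wordProd (letterMat n k) (letters true v) • (ell0 n α : OnePoint ℝ) := by
  rw [← L_mul_A, mul_smul, A_smul, r0_eq]

lemma isZeta_iff (hn : 3 ≤ n) (hk : 2 ≤ k) {ζ : ℝ} (hζ : ζ ∈ Set.Icc (0 : ℝ) 1) :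
    IsZeta n k v ζ ↔
      val n k ((1 - ζ) * t n - t n) (letters true v) = (1 - ζ) * t n := by
  have ht := two_le_t hn
  have hw : t n * ((1 - ζ) * t n - t n) ≤ 1 := by
    have : 0 ≤ t n * t n * ζ := by have := hζ.1; positivity
    nlinarith
  rw [← wordProd_smul_eq_iff hn hk hw, IsZeta, L_mul_A, and_iff_right hζ]
  have e₁ : ell0 n ζ = -((1 - ζ) * t n) := by rw [ell0]; ring
  have e₂ : r0 n ζ = -((1 - ζ) * t n - t n) := by rw [r0]; ring
  rw [e₁, e₂]

/-- Turns the equation for `η`, after multiplication by `M`, into `L · r₀(η) = -lowEnd n z`. -/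
lemma C_inv_A_C_smul (hn : 3 ≤ n) {z : ℝ} (hz : 0 ≤ z) :
    M n • C⁻¹ • ((-z : ℝ) : OnePoint ℝ) = ((-lowEnd n z : ℝ) : OnePoint ℝ) := by
  have ht := two_le_t hn
  have e : M n * C⁻¹ = C ^ 2 * A n * C := by
    have : C⁻¹ * C⁻¹ = C := by
      rw [C_inv, ← pow_add, pow_succ, C_pow_three, one_mul]
    rw [M_eq, ← C_inv, mul_assoc, this]
  rw [smul_smul, e, mul_smul, mul_smul]
  rcases C_smul_neg_cases z with ⟨rfl, h⟩ | ⟨h, h'⟩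
  · rw [h, A_smul_infty, C_sq_smul_infty]
    simp [lowEnd]
  · have hz' : 0 < z := lt_of_le_of_ne hz (Ne.symm h)
    have h₁ : 0 < 1 / z + t n := by positivity
    rw [h', A_smul, C_sq_smul (by linarith)]
    congr 1
    have h₂ : 1 - (1 + 1 / z + t n) = -(1 / lowEnd n z) := by
      rw [one_div_lowEnd h]
      ring
    rw [h₂, one_div_neg_eq_neg_one_div, one_div_one_div]

lemma isEta_iff (hn : 3 ≤ n) (hk : 2 ≤ k) {η : ℝ} (hη : η ∈ Set.Icc (0 : ℝ) 1) :
    IsEta n k v η ↔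
      val n k (lowEnd n ((1 - η) * t n)) (letters true v) = (1 - η) * t n := by
  have ht := two_le_t hn
  have hz : 0 ≤ (1 - η) * t n := mul_nonneg (by linarith [hη.2]) (by linarith)
  rw [← wordProd_smul_eq_iff hn hk (mul_lowEnd_le hn hz), IsEta, and_iff_right hη]
  have e : ell0 n η = -((1 - η) * t n) := by rw [ell0]; ring
  rw [← M_inv, mul_smul, inv_smul_eq_iff, L_smul_r0, e, C_inv_A_C_smul hn hz]

/-- Being increasing and `1`-Lipschitz, `lowEnd` preserves the contraction ratio of `val` when
inserted as its end value. -/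
lemma lowEnd_sub_le (hn : 3 ≤ n) {x y : ℝ} (hx : 0 ≤ x) (hxy : x ≤ y) :
    lowEnd n x ≤ lowEnd n y ∧ lowEnd n y - lowEnd n x ≤ y - x := by
  have ht := two_le_t hn
  have h₁ : 1 ≤ t n * x + 1 := by nlinarith
  have h₂ : 1 ≤ t n * y + 1 := by nlinarith
  have h₃ : 1 ≤ (t n * y + 1) * (t n * x + 1) := by nlinarith
  have e : lowEnd n y - lowEnd n x = (y - x) / ((t n * y + 1) * (t n * x + 1)) := by
    rw [lowEnd, lowEnd, div_sub_div _ _ (by linarith) (by linarith)]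
    congr 1
    ring
  have h₄ : 0 ≤ lowEnd n y - lowEnd n x := by
    rw [e]
    exact div_nonneg (by linarith) (by linarith)
  refine ⟨by linarith, ?_⟩
  rw [e]
  exact div_le_self (by linarith) h₃

lemma exists_fixed_point_val (hn : 3 ≤ n) (hk : 2 ≤ k) {ω : List Bool} (hω : ω ≠ []) {φ : ℝ → ℝ}
    (hφ : ∀ x ∈ Set.Icc 0 (t n), t n * φ x ≤ 1)
    (hφ' : ∀ x ∈ Set.Icc 0 (t n), ∀ y ∈ Set.Icc 0 (t n), x ≤ y → φ x ≤ φ y ∧ φ y - φ x ≤ y - x) :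
    ∃ p ∈ Set.Icc 0 (t n), val n k (φ p) ω = p ∧ ∀ x ∈ Set.Icc 0 (t n),
      (val n k (φ x) ω ≤ x ↔ p ≤ x) ∧ (x ≤ val n k (φ x) ω ↔ x ≤ p) := by
  have ht := two_le_t hn
  refine exists_fixed_point (F := fun x => val n k (φ x) ω) (by linarith) (fun x hx => ?_)
    (fun x hx y hy hxy => ?_)
  · have h₁ := mul_val_le hn hk (hφ x hx) ω
    have h₂ := val_pos hn hk (hφ x hx) hω
    exact ⟨h₂.le, by nlinarith⟩
  · obtain ⟨h₁, h₂⟩ := hφ' x hx y hy hxy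
    have h₃ := val_sub_le_div hn hk (hφ y hy) h₁ hω
    have h₄ := val_le_val hn hk (hφ y hy) h₁ ω
    rw [abs_of_nonneg (by linarith)]
    linarith

lemma exists_zeta (hn : 3 ≤ n) (hk : 2 ≤ k) (hv : letters true v ≠ []) :
    ∃ p ∈ Set.Icc 0 (t n), (∀ ζ, IsZeta n k v ζ ↔ (1 - ζ) * t n = p) ∧
      ∀ x ∈ Set.Icc 0 (t n), (x ≤ val n k (x - t n) (letters true v) ↔ x ≤ p) := by
  have ht := two_le_t hn
  obtain ⟨p, hp, hfix, hcmp⟩ := exists_fixed_point_val hn hk hv (φ := fun x => x - t n)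
    (fun x hx => by nlinarith [hx.2]) (fun x _ y _ hxy => ⟨by linarith, by linarith⟩)
  refine ⟨p, hp, fun ζ => ⟨fun h => ?_, fun h => ?_⟩, fun x hx => (hcmp x hx).2⟩
  · have hx : (1 - ζ) * t n ∈ Set.Icc 0 (t n) :=
      ⟨mul_nonneg (by linarith [h.1.2]) (by linarith), by nlinarith [h.1.1]⟩
    have e := (isZeta_iff hn hk h.1).mp h
    exact le_antisymm ((hcmp _ hx).2.mp e.ge) ((hcmp _ hx).1.mp e.le)
  · have hζ : ζ ∈ Set.Icc (0 : ℝ) 1 := by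
      rw [← h] at hp
      exact ⟨by nlinarith [hp.2], by nlinarith [hp.1]⟩
    rw [isZeta_iff hn hk hζ, h]
    exact hfix

lemma exists_eta (hn : 3 ≤ n) (hk : 2 ≤ k) (hv : letters true v ≠ []) :
    ∃ p ∈ Set.Icc 0 (t n), (∀ η, IsEta n k v η ↔ (1 - η) * t n = p) ∧
      val n k (lowEnd n p) (letters true v) = p ∧
      ∀ x ∈ Set.Icc 0 (t n), (x ≤ val n k (lowEnd n x) (letters true v) ↔ x ≤ p) := by
  have ht := two_le_t hn
  obtain ⟨p, hp, hfix, hcmp⟩ := exists_fixed_point_val hn hk hv (φ := lowEnd n)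
    (fun x hx => mul_lowEnd_le hn hx.1) (fun x hx y _ hxy => lowEnd_sub_le hn hx.1 hxy)
  refine ⟨p, hp, fun η => ⟨fun h => ?_, fun h => ?_⟩, hfix, fun x hx => (hcmp x hx).2⟩
  · have hx : (1 - η) * t n ∈ Set.Icc 0 (t n) :=
      ⟨mul_nonneg (by linarith [h.1.2]) (by linarith), by nlinarith [h.1.1]⟩
    have e := (isEta_iff hn hk h.1).mp h
    exact le_antisymm ((hcmp _ hx).2.mp e.ge) ((hcmp _ hx).1.mp e.le)
  · have hη : η ∈ Set.Icc (0 : ℝ) 1 := by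
      rw [← h] at hp
      exact ⟨by nlinarith [hp.2], by nlinarith [hp.1]⟩
    rw [isEta_iff hn hk hη, h]
    exact hfix

lemma existsUnique_of_iff (hn : 3 ≤ n) {P : ℝ → Prop} {p : ℝ}
    (h : ∀ x, P x ↔ (1 - x) * t n = p) : ∃! x, P x := by
  have ht : t n ≠ 0 := by linarith [two_le_t hn]
  refine ⟨1 - p / t n, (h _).mpr (by field_simp; ring), fun y hy => ?_⟩
  rw [← (h y).mp hy]
  field_simp
  ring

/-- A value `w` with `L · r₀(α) = -w` in the range given by the synchronization interval. -/
lemma exists_val_eq (hn : 3 ≤ n) (hk : 2 ≤ k) {ω : List Bool} {z : ℝ}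
    (hz : z ∈ Set.Icc 0 (t n)) (h₁ : val n k (z - t n) ω < z) (h₂ : z ≤ val n k (lowEnd n z) ω) :
    ∃ w, z - t n < w ∧ w ≤ lowEnd n z ∧ val n k w ω = z := by
  have ht := two_le_t hn
  have hlow := mul_lowEnd_le hn hz.1
  have hlow₀ : 0 ≤ lowEnd n z := div_nonneg hz.1 (by nlinarith [hz.1])
  have hle : z - t n ≤ lowEnd n z := by linarith [hz.2]
  have hb : ∀ x ∈ Set.Icc (z - t n) (lowEnd n z), t n * x ≤ 1 := fun x hx =>
    (mul_le_mul_of_nonneg_left hx.2 (by linarith)).trans hlow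
  have hlip : LipschitzOnWith 1 (fun w => val n k w ω) (Set.Icc (z - t n) (lowEnd n z)) := by
    apply LipschitzOnWith.of_dist_le_mul
    intro x hx y hy
    rw [Real.dist_eq, Real.dist_eq, NNReal.coe_one, one_mul]
    rcases le_total x y with h | h
    · rw [abs_sub_comm, abs_sub_comm x y, abs_of_nonneg (sub_nonneg.mpr h),
        abs_of_nonneg (sub_nonneg.mpr (val_le_val hn hk (hb y hy) h ω))]
      exact val_sub_le hn hk (hb y hy) h ω
    · rw [abs_of_nonneg (sub_nonneg.mpr h),
        abs_of_nonneg (sub_nonneg.mpr (val_le_val hn hk (hb x hx) h ω))]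
      exact val_sub_le hn hk (hb x hx) h ω
  obtain ⟨w, hw, hwz⟩ := intermediate_value_Icc hle hlip.continuousOn ⟨h₁.le, h₂⟩
  refine ⟨w, lt_of_le_of_ne hw.1 ?_, hw.2, hwz⟩
  rintro rfl
  exact h₁.ne hwz

end Interval

end TriangleCF

theorem mainTheorem9 (n k : ℕ) (hn : 3 ≤ n) (hk : 2 ≤ k)
    (v : List ℕ) (hv : TriangleCF.IsTreeWord v) :
    -- the interval `[η, ζ)` is well defined and non-empty
    (∃! η : ℝ, TriangleCF.IsEta n k v η) ∧
    (∃! ζ : ℝ, TriangleCF.IsZeta n k v ζ) ∧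
    (TriangleCF.syncInterval n k v).Nonempty ∧
    -- the group identity, in the projective group
    (TriangleCF.L n k v =
        TriangleCF.C⁻¹ * TriangleCF.A n * TriangleCF.C ^ 2 * TriangleCF.R n k v ∨
      TriangleCF.L n k v =
        -(TriangleCF.C⁻¹ * TriangleCF.A n * TriangleCF.C ^ 2 * TriangleCF.R n k v)) ∧
    ∀ α ∈ TriangleCF.syncInterval n k v,
      -- the initial digits of `r₀(α)`
      TriangleCF.upperDigits n α (TriangleCF.upperLen n k v) =
        (TriangleCF.upperSeq n k v).map some ∧
      -- the right and left matrices give the corresponding points of the two orbits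
      TriangleCF.r n α (TriangleCF.upperLen n k v) =
        TriangleCF.R n k v • ((TriangleCF.r0 n α : ℝ) : OnePoint ℝ) ∧
      TriangleCF.ell n α (TriangleCF.lowerLen v) =
        TriangleCF.L n k v • ((TriangleCF.r0 n α : ℝ) : OnePoint ℝ) ∧
      -- synchronization, with one more step on the right if the next right digit is `(1, 2)`
      (TriangleCF.digit n α (TriangleCF.r n α (TriangleCF.upperLen n k v)) = some (1, 2) →
        TriangleCF.ell n α (TriangleCF.lowerLen v + 1) =
          TriangleCF.r n α (TriangleCF.upperLen n k v + 2)) ∧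
      (TriangleCF.digit n α (TriangleCF.r n α (TriangleCF.upperLen n k v)) ≠ some (1, 2) →
        TriangleCF.ell n α (TriangleCF.lowerLen v + 1) =
          TriangleCF.r n α (TriangleCF.upperLen n k v + 1)) ∧
      -- the common value is a real number, unless both orbits reach a pole
      (TriangleCF.L n k v • ((TriangleCF.r0 n α : ℝ) : OnePoint ℝ) ≠ ((0 : ℝ) : OnePoint ℝ) →
        TriangleCF.L n k v • ((TriangleCF.r0 n α : ℝ) : OnePoint ℝ) ≠ ((1 : ℝ) : OnePoint ℝ) →
        ∃ y : ℝ, TriangleCF.ell n α (TriangleCF.lowerLen v + 1) = (y : OnePoint ℝ)) := by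
  have ht := TriangleCF.two_le_t hn
  have hadm := hv.admissible
  have hne : TriangleCF.letters true v ≠ [] := by
    obtain ⟨⟨τ, e, -⟩, -⟩ := hadm
    rw [e]
    exact List.cons_ne_nil _ _
  obtain ⟨pz, hpz, hzeta, hcmpz⟩ := TriangleCF.exists_zeta hn hk hne
  obtain ⟨pe, hpe, heta, hfix, hcmpe⟩ := TriangleCF.exists_eta hn hk hne
  have huz := TriangleCF.existsUnique_of_iff hn hzeta
  have hue := TriangleCF.existsUnique_of_iff hn heta
  have hid := TriangleCF.L_projEq hn hk v
  refine ⟨hue, huz, ?_, by rw [← TriangleCF.M_eq]; exact hid, ?_⟩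
  · obtain ⟨η, hη, -⟩ := hue
    obtain ⟨ζ, hζ, -⟩ := huz
    refine ⟨η, η, ζ, hη, hζ, le_rfl, ?_⟩
    have hlow : 0 ≤ TriangleCF.lowEnd n pe := div_nonneg hpe.1 (by nlinarith [hpe.1])
    -- In the coordinate `(1 - α) t` the order is reversed, so `η < ζ` means `pz < pe`. It holds
    -- since `pe - t < lowEnd n pe` and `val` is increasing in its end value.
    have hlt : ¬ pe ≤ pz := by
      rw [← hcmpz pe hpe, not_le]
      conv_rhs => rw [← hfix]
      refine TriangleCF.val_lt_val hn hk (TriangleCF.mul_lowEnd_le hn hpe.1) ?_ _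
      rcases hpe.1.eq_or_lt with h | h
      · rw [← h] at hlow ⊢
        linarith
      · have := TriangleCF.lowEnd_pos hn h
        linarith [hpe.2]
    have h₁ := (heta η).mp hη
    have h₂ := (hzeta ζ).mp hζ
    nlinarith
  · rintro α ⟨η, ζ, hη, hζ, hηα, hαζ⟩
    have h₁ := (heta η).mp hη
    have h₂ := (hzeta ζ).mp hζ
    obtain ⟨z, hzα⟩ : ∃ z, z = (1 - α) * TriangleCF.t n := ⟨_, rfl⟩
    have hα : TriangleCF.ell0 n α = -z := by rw [hzα, TriangleCF.ell0]; ring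
    have hz : z ∈ Set.Icc 0 (TriangleCF.t n) := by
      have := hη.1.1
      have := hζ.1.2
      rw [hzα]
      exact ⟨mul_nonneg (by linarith) (by linarith), by nlinarith⟩
    have hzpe : z ≤ pe := by rw [hzα, ← h₁]; nlinarith
    have hzpz : ¬ z ≤ pz := by rw [hzα, ← h₂, not_le]; nlinarith
    rw [← hcmpz z hz, not_le] at hzpz
    rw [← hcmpe z hz] at hzpe
    obtain ⟨w, hw₁, hw₂, hwz⟩ := TriangleCF.exists_val_eq hn hk hz hzpz hzpe
    have hw : TriangleCF.t n * w ≤ 1 := (mul_le_mul_of_nonneg_left hw₂ (by linarith)).trans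
      (TriangleCF.mul_lowEnd_le hn hz.1)
    have hz₀ : 0 < z := hwz ▸ TriangleCF.val_pos hn hk hw hne
    have hzt : TriangleCF.t n * z ≤ 1 := hwz ▸ TriangleCF.mul_val_le hn hk hw _
    have hwz' : w ≤ z := hw₂.trans (TriangleCF.lowEnd_le hn hz.1)
    have hbounds := fun s hs hs₀ => TriangleCF.val_suffix_bounds hn hk hadm hwz hw hw₁ hw₂
      (s := s) hs hs₀
    -- As `ω` starts with `true`, `1 + 1/z = k t - val τ`; now use `k ≥ 2` and `val τ ≤ z`.
    have hz₁ : 2 * TriangleCF.t n ≤ 1 + 1 / z + z := by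
      obtain ⟨⟨τ, e, -⟩, -⟩ := hadm
      have hτ : TriangleCF.val n k w τ ≤ z := by
        by_cases h : τ = []
        · rw [h]
          exact hwz'
        · exact (hbounds τ (e ▸ List.suffix_cons _ _) h).2
      have hk' : (2 : ℝ) ≤ k := by exact_mod_cast hk
      have h₃ : 1 / z = k * TriangleCF.t n - 1 - TriangleCF.val n k w τ := by
        rw [← hwz, e, TriangleCF.val_cons, TriangleCF.invBranch, one_div_one_div, if_pos rfl]
      nlinarith
    have hleft := TriangleCF.Follows.left hn hk hα hz₀ hzt hw hw₁ hwz' _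
      fun s hs hs₀ => (hbounds s hs hs₀).2
    have hright := TriangleCF.Follows.right hn hk hα hz₀ hzt hw hwz' _ hbounds
    rw [hwz] at hleft hright
    have hup := (TriangleCF.Follows.right_start hn hα hz₀ hzt hz₁).append hright
    have eup : TriangleCF.wpow [(1, 2)] (n - 2) ++
        (TriangleCF.letters true v).flatMap (TriangleCF.letterBlock n k) =
        TriangleCF.upperSeq n k v := by
      rw [TriangleCF.upperSeq, ← TriangleCF.expand_eq_flatMap]
      rfl
    rw [eup] at hup
    have hL : TriangleCF.L n k v • ((TriangleCF.r0 n α : ℝ) : OnePoint ℝ) =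
        ((-w : ℝ) : OnePoint ℝ) := by
      rw [TriangleCF.L_smul_r0, hα, TriangleCF.wordProd_smul_eq_iff hn hk hw, hwz]
    have hr : TriangleCF.r n α (TriangleCF.upperLen n k v) =
        ((TriangleCF.mirror n w : ℝ) : OnePoint ℝ) := hup.1
    have hl : TriangleCF.ell n α (TriangleCF.lowerLen v) = ((-w : ℝ) : OnePoint ℝ) := by
      have := hleft.1
      rwa [List.length_map, TriangleCF.length_letters, ← hα] at this
    have hl' : TriangleCF.ell n α (TriangleCF.lowerLen v + 1) =
        TriangleCF.T n α ((-w : ℝ) : OnePoint ℝ) := by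
      rw [← hl, TriangleCF.ell, Function.iterate_succ_apply', TriangleCF.ell]
    have hr₁ : TriangleCF.r n α (TriangleCF.upperLen n k v + 1) =
        TriangleCF.T n α ((TriangleCF.mirror n w : ℝ) : OnePoint ℝ) := by
      rw [← hr, TriangleCF.r, Function.iterate_succ_apply', TriangleCF.r]
    have hr₂ : TriangleCF.r n α (TriangleCF.upperLen n k v + 2) =
        TriangleCF.T n α (TriangleCF.T n α ((TriangleCF.mirror n w : ℝ) : OnePoint ℝ)) := by
      rw [← hr₁, TriangleCF.r, Function.iterate_succ_apply', TriangleCF.r]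
    have hsync := TriangleCF.synchronization hn hα hz₀ hzt hw₁ hw₂
    refine ⟨hup.2, ?_, by rw [hl, hL], ?_, ?_, ?_⟩
    · rw [hr, ← TriangleCF.M_inv_smul n (TriangleCF.sub_one_mul_lt_one hn hw), ← hL,
        hid.smul_eq, mul_smul, inv_smul_smul]
    · rw [hr, hl', hr₂]
      exact hsync.1
    · rw [hr, hl', hr₁]
      exact hsync.2
    · rw [hL, hl']
      intro h₃ h₄
      exact TriangleCF.T_real (fun h => h₃ (by rw [h])) (fun h => h₄ (by rw [h]))
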